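/- Let $\mathbb K=(\sigma_1,\dots,\sigma_m)$ be a filtered simplicial complex of dimension at most $d$, where $d\ge 1$ (the $\sigma_j$ are the simplices in filtration order, each after its faces), let $q_1,\dots,q_r$ be distinct primes, $Q=q_1\cdots q_r$ and $Q_S=\prod_{s\in S}q_s$ for $S\subseteq[r]$. For a field $\mathbb F$ let $\mathcal P_{\mathbb F}$ be the indexed persistence diagram of $\mathbb K$ with coefficients in $\mathbb F$ (all homological dimensions together): the set of pairs $(i,j)$, $1\le i\le m$, $j\in\{1,\dots,m,\infty\}$, of birth and death indices of the intervals of the sequence of $\mathbb F$-homology groups of the complexes $\{\sigma_1,\dots,\sigma_n\}$, $0\le n\le m$. Let $P_{\mathbb F}=|\mathcal P_{\mathbb F}|$. The multi-field persistence diagram $\mathcal P_r$ is the set of triples $(i,j,Q_S)$ such that $S=\{s:(i,j)\in\mathcal P_{\mathbb Z/q_s\mathbb Z}\}$ is non-empty. Let $P_r=|\mathcal P_r|$, and for $1\le j\le m$ let $|\mathcal L(j)|$ be the number of triples of $\mathcal P_r$ that die at $j$. Consider the modular reconstruction algorithm: it reduces the boundary matrix with coefficients in $\mathbb Z/Q\mathbb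 Z$ from left to right by partial column operations, simultaneously modulo all $q_s$, with partial inverses in $\mathbb Z/Q\mathbb Z$. It is implemented with sparse columns and the clearing optimization as follows. A column is a dictionary of its non-zero coefficients, with access to one coefficient in a single step. The columns are treated by decreasing dimension, and a column is not reduced modulo those primes for which its index is already known to be the birth index of a finite interval. For each entry $(i,Q_T)$ of a reduced column $j$ (that is, $i$ is the lowest non-zero index of column $j$ modulo $q_s$ exactly for $s\in T$) the product of the column with the partial inverse, with regard to $T$, of its $i$-th coefficient is computed once and stored, and the column operations use this stored column. The input is the sparse boundary matrix, the list of the primes and $Q$. Let $A_r$ be an upper bound on the time of each of the following: an addition or subtraction, a multiplication, a division, remainder, gcd or run of the extended Euclidean algorithm on integers of at most the size of $Q$, and an elementary memory step. Then the algorithm outputs $\mathcal P_r$, and for each of the fields $\mathbb F=\mathbb Z/q_s\mathbb Z$, $1\le s\le r$, its running time is $$O\Big(A_r\, r\,(P_r-P_{\mathbb F})+A_r\, d\,\Big[\sum_{(i,j,Q_S)\in\mathcal P_r,\ j\ne\infty}|j-i|^2\,|\mathcal L(j)|+\sum_{(i,\infty,Q_S)\in\mathcal P_r} i^2\,\max(1,|\mathcal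 L(i)|)\Big]\Big),$$ where the constant in $O(\cdot)$ is absolute: it depends neither on $\mathbb K$, $m$, $d$, $r$, the primes nor on $A_r$. -/

import Mathlib

namespace MultiField

/-! ### Filtered simplicial complexes, boundary matrices, indexed persistence diagrams -/

/-- A filtered simplicial complex with `m` simplices: the simplices (non-empty finite sets of
vertices) are listed in the order of the filtration, without repetition, and every proper face
of a simplex is listed before it.  The complex `K_n` consists of the first `n` simplices. -/
structure FilteredComplex (m : ℕ) where
  simplex : Fin m → Finset ℕ
  injective : Function.Injective simplex
  nonempty : ∀ j, (simplex j).Nonempty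
  face_mem : ∀ (j : Fin m) (τ : Finset ℕ), τ.Nonempty → τ ⊂ simplex j → ∃ i < j, simplex i = τ

variable {m : ℕ}

/-- The boundary matrix: column `j` is `∑ k, (-1)^k [v_0, …, v̂_k, …, v_p]` for the simplex
`σ_j = [v_0 < ⋯ < v_p]`.  (Column `j` vanishes if `σ_j` is a vertex, as `∅` is not listed.) -/
def FilteredComplex.boundaryMatrix (K : FilteredComplex m) (R : Type) [CommRing R] :
    Matrix (Fin m) (Fin m) R :=
  fun i j => ∑ v ∈ K.simplex j,
    if K.simplex i = (K.simplex j).erase v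
    then (-1 : R) ^ ((K.simplex j).filter (fun w => w < v)).card else 0

section Homology

variable (K : FilteredComplex m) (R : Type) [CommRing R]

/-- The boundary operator on the direct sum of all chain groups. -/
noncomputable def FilteredComplex.boundary : (Fin m → R) →ₗ[R] (Fin m → R) :=
  (K.boundaryMatrix R).mulVecLin

/-- The chains of `K_n`. -/
def FilteredComplex.chains (_K : FilteredComplex m) (R : Type) [CommRing R] (n : ℕ) :
    Submodule R (Fin m → R) where
  carrier := {c | ∀ i : Fin m, n ≤ (i : ℕ) → c i = 0}
  add_mem' := fun ha hb i hi => by simp [ha i hi, hb i hi]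
  zero_mem' := fun _ _ => rfl
  smul_mem' := fun a c hc i hi => by simp [hc i hi]

/-- The cycles of `K_n`. -/
noncomputable def FilteredComplex.cycles (n : ℕ) : Submodule R (Fin m → R) :=
  K.chains R n ⊓ LinearMap.ker (K.boundary R)

/-- The boundaries of `K_n`. -/
noncomputable def FilteredComplex.boundaries (n : ℕ) : Submodule R (Fin m → R) :=
  (K.chains R n).map (K.boundary R)

theorem FilteredComplex.chains_mono {a b : ℕ} (h : a ≤ b) : K.chains R a ≤ K.chains R b :=
  fun _ hc i hi => hc i (h.trans hi)

theorem FilteredComplex.cycles_mono {a b : ℕ} (h : a ≤ b) : K.cycles R a ≤ K.cycles R b :=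
  inf_le_inf_right _ (K.chains_mono R h)

theorem FilteredComplex.boundaries_mono {a b : ℕ} (h : a ≤ b) :
    K.boundaries R a ≤ K.boundaries R b :=
  Submodule.map_mono (K.chains_mono R h)

/-- The total homology `⨁_p H_p(K_n, R)`: cycles of `K_n` modulo boundaries of `K_n`. -/
abbrev FilteredComplex.Homology (n : ℕ) : Type :=
  ↥(K.cycles R n) ⧸ (K.boundaries R n).comap (K.cycles R n).subtype

/-- The map `H(K_a, R) → H(K_b, R)` induced by the inclusion, for `a ≤ b`. -/
noncomputable def FilteredComplex.homologyMap {a b : ℕ} (h : a ≤ b) :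
    K.Homology R a →ₗ[R] K.Homology R b :=
  Submodule.mapQ _ _ (Submodule.inclusion (K.cycles_mono R h))
    (fun _ hc => K.boundaries_mono R h hc)

/-- The persistent Betti number: the rank of `H(K_a, R) → H(K_b, R)`, for `a ≤ b`. -/
noncomputable def FilteredComplex.persistentBetti (a b : ℕ) : ℕ :=
  if h : a ≤ b then Module.finrank R (LinearMap.range (K.homologyMap R h)) else 0

/-- The multiplicity, in the interval decomposition of `H(K_0) → ⋯ → H(K_m)`, of the interval
born with simplex `i` and dying with simplex `j` (never dying, for `⊤`). -/
noncomputable def FilteredComplex.multiplicity (i : Fin m) : WithTop (Fin m) → ℤ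
  | some j =>
      if i < j then
        ((K.persistentBetti R (i + 1) j : ℤ) - K.persistentBetti R i j)
          - ((K.persistentBetti R (i + 1) (j + 1) : ℤ) - K.persistentBetti R i (j + 1))
      else 0
  | none => (K.persistentBetti R (i + 1) m : ℤ) - K.persistentBetti R i m

open Classical in
/-- The indexed persistence diagram with coefficients in `R` (used for fields only). -/
noncomputable def FilteredComplex.diagram : Finset (Fin m × WithTop (Fin m)) :=
  Finset.univ.filter (fun p => 0 < K.multiplicity R p.1 p.2)

open Classical in
/-- The multi-field persistence diagram for `ℤ/q_1, …, ℤ/q_r`: the triples `(i, j, S)` where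
`S` is the set, required to be non-empty, of all `s` such that `(i, j)` is in the diagram over
`ℤ/q_s`. -/
noncomputable def FilteredComplex.multiDiagram {r : ℕ} (q : Fin r → ℕ) :
    Finset (Fin m × WithTop (Fin m) × Finset (Fin r)) :=
  Finset.univ.filter (fun t =>
    t.2.2.Nonempty ∧ ∀ s, s ∈ t.2.2 ↔ (t.1, t.2.1) ∈ K.diagram (ZMod (q s)))

open Classical in
/-- `|𝓛(j)|`: the number of triples of the multi-field diagram that die at `j`. -/
noncomputable def FilteredComplex.numDying {r : ℕ} (q : Fin r → ℕ) (j : Fin m) : ℕ :=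
  ((K.multiDiagram q).filter (fun t => t.2.1 = (j : WithTop (Fin m)))).card

end Homology

/-! ### Counting operations -/

/-- Numbers of operations, by kind, on integers in `[0, Q]`: additions and subtractions;
multiplications; divisions, remainders, gcd's and runs of the extended Euclidean algorithm;
elementary memory steps (reading, writing or comparing one stored item). -/
@[ext] structure OpCount where
  add : ℕ := 0
  mul : ℕ := 0
  div : ℕ := 0
  mem : ℕ := 0

/-- The running time, if one operation of each kind takes the given time. -/
def OpCount.time (c : OpCount) (tAdd tMul tDiv tMem : ℝ) : ℝ :=
  c.add * tAdd + c.mul * tMul + c.div * tDiv + c.mem * tMem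

/-- A value together with the number of operations spent on computing it. -/
structure Counted (α : Type) where
  val : α
  ops : OpCount

instance : Monad Counted where
  pure a := ⟨a, {}⟩
  bind x f :=
    ⟨(f x.val).val,
      { add := x.ops.add + (f x.val).ops.add
        mul := x.ops.mul + (f x.val).ops.mul
        div := x.ops.div + (f x.val).ops.div
        mem := x.ops.mem + (f x.val).ops.mem }⟩

/-- Record the execution of some operations. -/
def tick (c : OpCount) : Counted Unit := ⟨(), c⟩

/-! ### Arithmetic in `ℤ/Q`, where `Q` is the product of the distinct primes in a list `qs`.
A set `S` of these primes is represented by its product `Q_S`. -/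

variable {Q : ℕ}

/-- The sum of the idempotents `ν_q` of the Chinese remainder theorem, `ν_q ≡ 1` modulo `q` and
`ν_q ≡ 0` modulo `Q / q`, over the primes `q` in the list that divide `QT`. -/
def crtSum (Q QT : ℕ) : List ℕ → Counted (ZMod Q)
  | [] => pure 0
  | q :: qs => do
      let acc ← crtSum Q QT qs
      tick { div := 1, mem := 1 }
      if q ∣ QT then
        tick { div := 2, mul := 1, add := 1 }
        pure (acc + ((Q / q : ℕ) : ZMod Q) * ((Nat.gcdA (Q / q) q : ℤ) : ZMod Q))
      else pure acc

/-- The partial identity `L_T`. -/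
def partialIdentity (Q : ℕ) (qs : List ℕ) (QT : ℕ) : Counted (ZMod Q) := do
  tick { mem := 1 }
  if QT = Q then pure 1 else crtSum Q QT qs

/-- The partial inverse of `x` with regard to `S`. -/
def partialInverse (Q : ℕ) (qs : List ℕ) (x : ZMod Q) (QS : ℕ) : Counted (ZMod Q) := do
  tick { div := 3, mul := 1 }
  let QT := QS / Nat.gcd x.val QS
  let L ← partialIdentity Q qs QT
  pure (((Nat.gcdA x.val QT : ℤ) : ZMod Q) * L)

/-! ### Sparse columns
A column is a dictionary holding its non-zero coefficients only, with access to a given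
coefficient in one step; an operation on a column is charged for each stored coefficient that it
goes through. -/

/-- The number of stored (non-zero) coefficients. -/
def nnz (c : Fin m → ZMod Q) : ℕ := (Finset.univ.filter (fun i => c i ≠ 0)).card

/-- `a × c`. -/
def scale (a : ZMod Q) (c : Fin m → ZMod Q) : Counted (Fin m → ZMod Q) := do
  tick { mul := nnz c, mem := nnz c }
  pure (a • c)

/-- `c - a × c'`. -/
def subMul (c : Fin m → ZMod Q) (a : ZMod Q) (c' : Fin m → ZMod Q) :
    Counted (Fin m → ZMod Q) := do
  tick { mul := nnz c', add := nnz c', mem := nnz c' }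
  pure (c - a • c')

/-- The extended `low` function: the largest index of a coefficient that is non-zero
modulo `QS`, or `⊥`. -/
def low (c : Fin m → ZMod Q) (QS : ℕ) : Counted (WithBot (Fin m)) := do
  tick { div := nnz c, mem := nnz c + 1 }
  pure (Finset.univ.filter (fun i => ¬ QS ∣ (c i).val)).max

/-! ### The modular reconstruction algorithm -/

/-- An entry `(i, Q_T)` of `𝓛(j)` in the index table, stored at the row `i`.  Besides `j` and `Q_T`
it keeps the product of the reduced column `j` and of the partial inverse, with regard to `T`, of
its coefficient `i`; this is the column that operations with `(i, Q_T)` make use of. -/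
structure Entry (m Q : ℕ) where
  column : Fin m
  QT : ℕ
  vec : Fin m → ZMod Q

/-- The memory of the algorithm. -/
structure State (m Q : ℕ) where
  /-- the index table: the entries with a given lowest index -/
  table : Fin m → List (Entry m Q)
  /-- the product of the primes for which the index is not yet known to be a birth index of a
  finite interval -/
  open_ : Fin m → ℕ
  /-- the part of the multi-field persistence diagram found so far, with `Q_S` for `S` -/
  output : List (Fin m × WithTop (Fin m) × ℕ)

/-- The inner loop.  The column `c` is reduced at its row `k` by the entries found there,
for as many of the primes dividing `QT` as possible; the other primes are returned. -/
def reduceRow (k : Fin m) : List (Entry m Q) → ℕ → (Fin m → ZMod Q) →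
    Counted (ℕ × (Fin m → ZMod Q))
  | [], QT, c => pure (QT, c)
  | e :: es, QT, c => do
      tick { div := 1, mem := 2 }
      if 1 < Nat.gcd e.QT QT then
        tick { div := 1 }
        let c' ← subMul c (c k) e.vec
        reduceRow k es (QT / Nat.gcd e.QT QT) c'
      else reduceRow k es QT c

/-- A new entry `(k, Q_T)` of `𝓛(j)` is found: store it and its triple, and remove from `c` its
component at the primes dividing `QT`, which is reduced. -/
def record (qs : List ℕ) (j k : Fin m) (QT : ℕ) (c : Fin m → ZMod Q) (st : State m Q) :
    Counted ((Fin m → ZMod Q) × State m Q) := do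
  let a ← partialInverse Q qs (c k) QT
  let v ← scale a c
  let c' ← subMul c (c k) v
  tick { div := 1, mem := 3 }
  pure (c',
    { table := Function.update st.table k (st.table k ++ [⟨j, QT, v⟩])
      open_ := Function.update st.open_ k (st.open_ k / QT)
      output := st.output ++ [(k, (j : WithTop (Fin m)), QT)] })

/-- The outer loop: `QS` is the product of the primes for which the column `c`, the current state
of column `j`, is not yet reduced.  The row `low(c, QS)` strictly decreases from one round to the
next, so that `m + 1` rounds (the parameter `fuel`) suffice.  If the loop ends with `QS ≠ 1`,
the column is zero for the remaining primes, which gives an infinite interval. -/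
def reduceColumn (qs : List ℕ) (j : Fin m) :
    (fuel : ℕ) → (QS : ℕ) → (Fin m → ZMod Q) → State m Q → Counted (State m Q)
  | 0, _, _, st => pure st
  | fuel + 1, QS, c, st => do
      match ← low c QS with
      | none =>
          tick { mem := 2 }
          if QS = 1 then pure st
          else pure { st with output := st.output ++ [(j, ⊤, QS)] }
      | some k =>
          tick { div := 2, mem := 2 }
          let p ← reduceRow k (st.table k) (QS / Nat.gcd (c k).val QS) c
          if p.1 = 1 then reduceColumn qs j fuel QS p.2 st
          else
            let x ← record qs j k p.1 p.2 st
            tick { div := 1 }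
            reduceColumn qs j fuel (QS / p.1) x.1 x.2

/-- The treatment of column `j`, with the clearing optimization: the primes for which `j` is
already known to be a birth index, and column `j` therefore reduces to zero, are left out. -/
def handleColumn (K : FilteredComplex m) (qs : List ℕ) (j : Fin m) (st : State m Q) :
    Counted (State m Q) := do
  tick { mem := 2 }
  if st.open_ j = 1 then pure st
  else
    let c : Fin m → ZMod Q := fun i => K.boundaryMatrix (ZMod Q) i j
    tick { mem := nnz c }
    if st.open_ j = Q then reduceColumn qs j (m + 1) (st.open_ j) c st
    else
      let L ← partialIdentity Q qs (st.open_ j)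
      let c' ← scale L c
      reduceColumn qs j (m + 1) (st.open_ j) c' st

/-- Treat the columns of a list in turn. -/
def handleColumns (K : FilteredComplex m) (qs : List ℕ) :
    List (Fin m) → State m Q → Counted (State m Q)
  | [], st => pure st
  | j :: js, st => do
      let st' ← handleColumn K qs j st
      handleColumns K qs js st'

/-- The columns by decreasing dimension of their simplices, those of the same dimension from left
to right (as clearing requires). -/
def columnOrder (K : FilteredComplex m) : List (Fin m) :=
  (List.range (m + 1)).reverse.flatMap
    (fun p => (List.finRange m).filter (fun j => (K.simplex j).card = p))

/-- The modular reconstruction algorithm with clearing, on sparse columns, for the primes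
`q_1, …, q_r`.  It returns the multi-field persistence diagram.  The first line pays for setting
up the memory and for sorting the columns by dimension (there are at most `m` vertices, so bucket
sort will do).  The input consists of the sparse boundary matrix, the primes and their product. -/
def modularReconstruction (K : FilteredComplex m) {r : ℕ} (q : Fin r → ℕ) :
    Counted (List (Fin m × WithTop (Fin m) × ℕ)) := do
  tick { mem := 5 * m }
  let st ← handleColumns K (List.ofFn q) (columnOrder K)
    ({ table := fun _ => [], open_ := fun _ => ∏ s, q s, output := [] } : State m (∏ s, q s))
  pure st.output

end MultiField

/-!
The theorem has a linear algebra part, an invariant of the algorithm, and an amortized count.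

*Diagrams from reduced columns.*  Over a field, call a relation `pair k j` between rows and columns
a pairing (`FilteredComplex.IsPairing`) if, for each paired column `j`, there is a chain with last
simplex `j` whose boundary has lowest index `k`, no row is paired with two columns, and for every
unpaired column there is a cycle with last simplex `j`.  The dimension of a space of chains is the
number of lowest indices of its elements, so the persistent Betti numbers count pairs, and the
persistence diagram consists of the pairs and of the indices that are in no pair
(`mem_diagram_coe`, `mem_diagram_top`).  Since `∂ ∘ ∂ = 0`, every index is an endpoint of exactly
one interval.

*The invariant.*  Every column that the algorithm holds is the boundary, over `ℤ/Q`, of an explicit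
chain (`IsReduction`).  Projecting to the fields `ℤ/q_s` shows that the entries of the final table
form a pairing modulo each prime (`StateInv.isPairing`); columns that have been cleared are births,
and the reduced column paired with them is a cycle.  Modulo `q_s` only one triple per column is
output, and one row gives rise to at most one entry per column, so the triples collect exactly the
primes with the same interval (`StateInv.mem_output_iff`).

*The cost of a column.*  While the rows of index at least `lo` are reduced in column `j`, the chain
is supported in `[lo, j]`, so that the column has `O(d (j - lo))` coefficients; likewise an entry
`(k, j', T)` has `O(d (j' - k))` of them.  Thus column `j`, if it goes down to the row `j - n`, costs
`O(d n²)` for the searches, `O(d n)` for each new entry, and `O(d ∑ (j' - k))` for the column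
operations, the sum being over all the finite intervals `(k, j')` nested in `(j - n, j)`
(`reduceColumn_spec`).

*Amortization.*  That sum may be larger than `n²`, because one row may be paired with many columns
modulo different primes.  Let `V(j')` be the sum of the lengths of the intervals that die at `j'`.
The columns `j'` with `V(j') ≤ j - j'` contribute at most `n²` to the sum.  Every other `j'` occurs
for fewer than `V(j')` columns `j`, so that over all the columns these contribute at most
`∑ V(j')²`, and `V(j')²` is bounded by the number of intervals that die at `j'` times the sum of the
squares of their lengths, by the Cauchy-Schwarz inequality (`sum_scanWeight_le`, `sum_excess_le`).

*Partial inverses.*  The cost `O(r)` of a partial identity arises only for an entry or a column that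
does not concern all the primes.  At the index in question there is then an interval that does not
exist modulo `q_{s₀}`; as each index is the endpoint of one interval modulo `q_{s₀}`, this happens
`O(P_r - P_𝔽)` times (`sum_card_filter_ne_univ_le`, `card_touched_le`).
-/

namespace MultiField

/-! ### The boundary matrix -/

section BoundaryMatrix

variable {m : ℕ} (K : FilteredComplex m) (R : Type) [CommRing R]

theorem FilteredComplex.simplex_eq_erase_of_boundaryMatrix_ne_zero {i j : Fin m}
    (h : K.boundaryMatrix R i j ≠ 0) : ∃ v ∈ K.simplex j, K.simplex i = (K.simplex j).erase v := by
  obtain ⟨v, hv, hne⟩ := Finset.exists_ne_zero_of_sum_ne_zero h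
  exact ⟨v, hv, by_contra fun hn => hne (if_neg hn)⟩

theorem FilteredComplex.card_add_one_of_boundaryMatrix_ne_zero {i j : Fin m}
    (h : K.boundaryMatrix R i j ≠ 0) : (K.simplex i).card + 1 = (K.simplex j).card := by
  obtain ⟨v, hv, he⟩ := K.simplex_eq_erase_of_boundaryMatrix_ne_zero R h
  rw [he, Finset.card_erase_add_one hv]

/-- The boundary matrix is strictly upper triangular, because faces precede their cofaces. -/
theorem FilteredComplex.lt_of_boundaryMatrix_ne_zero {i j : Fin m}
    (h : K.boundaryMatrix R i j ≠ 0) : i < j := by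
  obtain ⟨v, hv, he⟩ := K.simplex_eq_erase_of_boundaryMatrix_ne_zero R h
  obtain ⟨i', hi', he'⟩ := K.face_mem j _ (he ▸ K.nonempty i) (Finset.erase_ssubset hv)
  rwa [← K.injective (he'.trans he.symm)]

theorem FilteredComplex.card_filter_boundaryMatrix_ne_zero_le (j : Fin m) [DecidableEq R] :
    (Finset.univ.filter (fun i => K.boundaryMatrix R i j ≠ 0)).card ≤ (K.simplex j).card := by
  calc _ = ((Finset.univ.filter (fun i => K.boundaryMatrix R i j ≠ 0)).image K.simplex).card :=
        (Finset.card_image_of_injective _ K.injective).symm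
    _ ≤ ((K.simplex j).image (fun v => (K.simplex j).erase v)).card := by
        refine Finset.card_le_card fun τ hτ => ?_
        obtain ⟨i, hi, rfl⟩ := Finset.mem_image.1 hτ
        obtain ⟨v, hv, he⟩ :=
          K.simplex_eq_erase_of_boundaryMatrix_ne_zero R (Finset.mem_filter.1 hi).2
        exact Finset.mem_image.2 ⟨v, hv, he.symm⟩
    _ ≤ _ := Finset.card_image_le

theorem FilteredComplex.map_boundaryMatrix {R' : Type} [CommRing R'] (f : R →+* R')
    (i j : Fin m) : f (K.boundaryMatrix R i j) = K.boundaryMatrix R' i j := by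
  simp only [boundaryMatrix, map_sum]
  refine Finset.sum_congr rfl fun v _ => ?_
  split_ifs <;> simp

theorem card_filter_lt_erase_of_le {s : Finset ℕ} {v w : ℕ} (h : w ≤ v) :
    ((s.erase v).filter (· < w)).card = (s.filter (· < w)).card := by
  rw [Finset.filter_erase, Finset.erase_eq_of_notMem]
  simp only [Finset.mem_filter, not_and, not_lt]
  exact fun _ => h

theorem card_filter_lt_erase_add_one {s : Finset ℕ} {v w : ℕ} (hv : v ∈ s) (h : v < w) :
    ((s.erase v).filter (· < w)).card + 1 = (s.filter (· < w)).card := by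
  rw [Finset.filter_erase, Finset.card_erase_add_one (Finset.mem_filter.2 ⟨hv, h⟩)]

/-- Deleting two vertices in the two possible orders gives opposite signs. -/
theorem neg_one_pow_erase_add_swap {s : Finset ℕ} {v w : ℕ} (hv : v ∈ s) (hw : w ∈ s)
    (hne : v ≠ w) :
    (-1 : R) ^ (s.filter (· < v)).card * (-1) ^ ((s.erase v).filter (· < w)).card +
      (-1) ^ (s.filter (· < w)).card * (-1) ^ ((s.erase w).filter (· < v)).card = 0 := by
  rcases lt_or_gt_of_ne hne with h | h
  · rw [← card_filter_lt_erase_add_one hv h, card_filter_lt_erase_of_le h.le, pow_succ]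
    ring
  · rw [← card_filter_lt_erase_add_one hw h, card_filter_lt_erase_of_le h.le, pow_succ]
    ring

theorem FilteredComplex.boundaryMatrix_mul_self :
    K.boundaryMatrix R * K.boundaryMatrix R = 0 := by
  ext i j
  let G : Finset ℕ → R := fun τ => ∑ w ∈ τ,
    if K.simplex i = τ.erase w then (-1 : R) ^ (τ.filter (fun x => x < w)).card else 0
  have hface : ∀ v ∈ K.simplex j, ∑ k, (if K.simplex k = (K.simplex j).erase v
      then G (K.simplex k) else 0) = G ((K.simplex j).erase v) := by
    intro v hv
    rcases Finset.eq_empty_or_nonempty ((K.simplex j).erase v) with he | he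
    · rw [he, Finset.sum_eq_zero]
      · simp [G]
      · intro k _
        rw [if_neg (K.nonempty k).ne_empty]
    · obtain ⟨k, _, hk⟩ := K.face_mem j _ he (Finset.erase_ssubset hv)
      rw [Finset.sum_eq_single k]
      · rw [if_pos hk, hk]
      · intro k' _ hk'
        rw [if_neg fun h => hk' (K.injective (h.trans hk.symm))]
      · simp
  have hsum : (K.boundaryMatrix R * K.boundaryMatrix R) i j =
      ∑ v ∈ K.simplex j, ∑ w ∈ (K.simplex j).erase v,
        if K.simplex i = ((K.simplex j).erase v).erase w
        then (-1 : R) ^ ((K.simplex j).filter (· < v)).card *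
          (-1) ^ (((K.simplex j).erase v).filter (· < w)).card else 0 := by
    rw [Matrix.mul_apply]
    calc _ = ∑ k, ∑ v ∈ K.simplex j, (-1 : R) ^ ((K.simplex j).filter (· < v)).card *
            (if K.simplex k = (K.simplex j).erase v then G (K.simplex k) else 0) := by
          refine Finset.sum_congr rfl fun k _ => ?_
          change G (K.simplex k) * _ = _
          rw [boundaryMatrix, Finset.mul_sum]
          refine Finset.sum_congr rfl fun v _ => ?_
          split_ifs <;> ring
      _ = _ := by
          rw [Finset.sum_comm]
          refine Finset.sum_congr rfl fun v hv => ?_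
          rw [← Finset.mul_sum, hface v hv, Finset.mul_sum]
          refine Finset.sum_congr rfl fun w _ => ?_
          split_ifs <;> ring
  rw [hsum, Finset.sum_sigma', Matrix.zero_apply]
  refine Finset.sum_involution (fun p _ => ⟨p.2, p.1⟩) ?_ ?_ ?_ ?_
  · rintro ⟨v, w⟩ hp
    simp only [Finset.mem_sigma, Finset.mem_erase] at hp
    simp only [Finset.erase_right_comm (a := w) (b := v)]
    split_ifs
    · exact neg_one_pow_erase_add_swap R hp.1 hp.2.2 hp.2.1.symm
    · simp
  · rintro ⟨v, w⟩ hp _ he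
    simp only [Finset.mem_sigma, Finset.mem_erase] at hp
    simp only [Sigma.mk.injEq, heq_eq_eq] at he
    exact hp.2.1 he.1
  · rintro ⟨v, w⟩ hp
    simp only [Finset.mem_sigma, Finset.mem_erase] at hp ⊢
    exact ⟨hp.2.2, hp.2.1.symm, hp.1⟩
  · rintro ⟨v, w⟩ _
    rfl

theorem FilteredComplex.boundary_boundary (c : Fin m → R) :
    K.boundary R (K.boundary R c) = 0 := by
  simp [boundary, Matrix.mulVec_mulVec, boundaryMatrix_mul_self]

theorem FilteredComplex.boundary_apply (c : Fin m → R) (i : Fin m) :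
    K.boundary R c i = ∑ j, K.boundaryMatrix R i j * c j := rfl

end BoundaryMatrix

/-! ### Pairings of simplices and persistence diagrams over a field -/

section Pairing

variable {m : ℕ} (K : FilteredComplex m) {F : Type} [Field F]

/-- `k` is the index of the lowest non-zero coefficient of `c`. -/
def HasLow {R : Type} [Zero R] (c : Fin m → R) (k : Fin m) : Prop :=
  c k ≠ 0 ∧ ∀ i, k < i → c i = 0

theorem HasLow.unique {R : Type} [Zero R] {c : Fin m → R} {k k' : Fin m} (h : HasLow c k)
    (h' : HasLow c k') : k = k' := by
  rcases lt_trichotomy k k' with hlt | he | hlt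
  · exact absurd (h.2 _ hlt) h'.1
  · exact he
  · exact absurd (h'.2 _ hlt) h.1

theorem exists_hasLow {R : Type} [Zero R] {c : Fin m → R} (h : c ≠ 0) : ∃ k, HasLow c k := by
  classical
  have hne : (Finset.univ.filter (fun i => c i ≠ 0)).Nonempty := by
    obtain ⟨i, hi⟩ := Function.ne_iff.1 h
    exact ⟨i, by simpa using hi⟩
  refine ⟨_, (Finset.mem_filter.1 (Finset.max'_mem _ hne)).2, fun i hi => ?_⟩
  by_contra hci
  exact absurd (Finset.le_max' _ i (by simpa using hci)) (not_le.2 hi)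

theorem HasLow.smul {c : Fin m → F} {k : Fin m} (h : HasLow c k) {a : F} (ha : a ≠ 0) :
    HasLow (a • c) k :=
  ⟨mul_ne_zero ha h.1, fun i hi => by simp [h.2 i hi]⟩

/-- The echelon form criterion for the dimension. -/
theorem finrank_eq_card_of_hasLow (W : Submodule F (Fin m → F)) (L : Finset (Fin m))
    (h₁ : ∀ i ∈ L, ∃ w ∈ W, HasLow w i) (h₂ : ∀ w ∈ W, ∀ i, HasLow w i → i ∈ L) :
    Module.finrank F W = L.card := by
  classical
  have hcard : Module.finrank F (L → F) = L.card := by simp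
  apply le_antisymm
  · rw [← hcard]
    let f : W →ₗ[F] (L → F) := LinearMap.pi fun i => LinearMap.proj i.1 ∘ₗ W.subtype
    refine LinearMap.finrank_le_finrank_of_injective (f := f) ?_
    rw [injective_iff_map_eq_zero]
    rintro ⟨w, hw⟩ hf
    by_contra hne
    obtain ⟨i, hi⟩ := exists_hasLow (c := w) (by simpa using hne)
    exact hi.1 (congrFun hf ⟨i, h₂ w hw i hi⟩)
  · rw [← hcard]
    choose! w hw hlow using h₁
    let f : (L → F) →ₗ[F] W :=
      Fintype.linearCombination F fun i : L => (⟨w i.1, hw i.1 i.2⟩ : W)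
    refine LinearMap.finrank_le_finrank_of_injective (f := f) ?_
    rw [injective_iff_map_eq_zero]
    intro a ha
    by_contra hne
    have hne' : (Finset.univ.filter (fun i : L => a i ≠ 0)).Nonempty := by
      obtain ⟨i, hi⟩ := Function.ne_iff.1 hne
      exact ⟨i, by simpa using hi⟩
    set i := Finset.max' _ hne' with hi
    have hai : a i ≠ 0 := (Finset.mem_filter.1 (Finset.max'_mem _ hne')).2
    have hz : ((f a : W) : Fin m → F) i.1 = 0 := by rw [ha]; rfl
    simp only [f, Fintype.linearCombination_apply, Submodule.coe_sum, Submodule.coe_smul,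
      Finset.sum_apply, Pi.smul_apply, smul_eq_mul] at hz
    rw [Finset.sum_eq_single i] at hz
    · exact mul_ne_zero hai (hlow i.1 i.2).1 hz
    · intro l _ hl
      rcases lt_or_gt_of_ne hl with h | h
      · rw [(hlow l.1 l.2).2 i.1 h, mul_zero]
      · rw [show a l = 0 from by_contra fun hal =>
          absurd (Finset.le_max' _ l (by simpa using hal)) (not_le.2 h), zero_mul]
    · simp

theorem FilteredComplex.lt_of_hasLow_boundary {v : Fin m → F} {k j : Fin m} (hv : HasLow v j)
    (h : HasLow (K.boundary F v) k) : k < j := by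
  have h₀ := h.1
  rw [K.boundary_apply] at h₀
  obtain ⟨l, _, hl⟩ := Finset.exists_ne_zero_of_sum_ne_zero h₀
  have h₁ := K.lt_of_boundaryMatrix_ne_zero F (left_ne_zero_of_mul hl)
  have h₂ : l ≤ j := not_lt.1 fun h' => right_ne_zero_of_mul hl (hv.2 l h')
  exact h₁.trans_le h₂

/-- The outcome of a matrix reduction over the field `F`: `pair k j` says that column `j` is
reduced to a column with lowest index `k`.  The reduced columns have different lowest indices, and
every other column reduces to zero. -/
structure FilteredComplex.IsPairing (F : Type) [Field F] (pair : Fin m → Fin m → Prop) :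
    Prop where
  cert : ∀ {k j}, pair k j → ∃ v : Fin m → F, HasLow v j ∧ HasLow (K.boundary F v) k
  inj : ∀ {k j j'}, pair k j → pair k j' → j = j'
  total : ∀ j, (∃ k, pair k j) ∨ ∃ v : Fin m → F, HasLow v j ∧ K.boundary F v = 0

namespace FilteredComplex.IsPairing

variable {K} {pair : Fin m → Fin m → Prop} (hp : K.IsPairing F pair)
include hp

theorem exists_pair_of_hasLow_boundary (n : ℕ) (c : Fin m → F) (hc : c ∈ K.chains F n)
    (k : Fin m) (hk : HasLow (K.boundary F c) k) : ∃ j : Fin m, (j : ℕ) < n ∧ pair k j := by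
  induction n generalizing c k with
  | zero =>
    have : c = 0 := funext fun i => hc i (Nat.zero_le _)
    exact absurd (by simp [this]) hk.1
  | succ n ih =>
    by_cases hn : n < m
    swap
    · obtain ⟨j, hj, h⟩ := ih c (fun i hi => absurd i.2 (by omega)) k hk
      exact ⟨j, by omega, h⟩
    -- Subtract the multiple of `v` that removes the last coefficient of `c`.
    have hred : ∀ v : Fin m → F, HasLow v ⟨n, hn⟩ →
        c - (c ⟨n, hn⟩ / v ⟨n, hn⟩) • v ∈ K.chains F n := by
      intro v hv i hi
      rcases hi.eq_or_lt with h | h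
      · obtain rfl : i = ⟨n, hn⟩ := Fin.ext h.symm
        simp [div_mul_cancel₀ _ hv.1]
      · simp [hc i h, hv.2 i h]
    rcases hp.total ⟨n, hn⟩ with ⟨k', hk'⟩ | ⟨v, hv, hv0⟩
    · obtain ⟨v, hv, hvk'⟩ := hp.cert hk'
      set a := c ⟨n, hn⟩ / v ⟨n, hn⟩
      have hsplit : K.boundary F c = K.boundary F (c - a • v) + a • K.boundary F v := by
        simp
      by_cases ha : a = 0
      · have h₀ : c - a • v = c := by rw [ha, zero_smul, sub_zero]
        obtain ⟨j, hj, h⟩ := ih _ (hred v hv) k (by rwa [h₀])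
        exact ⟨j, by omega, h⟩
      have hav := hvk'.smul ha
      by_cases h0 : K.boundary F (c - a • v) = 0
      · rw [h0, zero_add] at hsplit
        rw [hsplit] at hk
        rw [hk.unique hav]
        exact ⟨_, Nat.lt_succ_self n, hk'⟩
      obtain ⟨k'', hk''⟩ := exists_hasLow h0
      obtain ⟨j, hj, hpj⟩ := ih _ (hred v hv) k'' hk''
      have hne : k'' ≠ k' := by
        rintro rfl
        have := congrArg Fin.val (hp.inj hpj hk')
        simp at this
        omega
      rcases lt_or_gt_of_ne hne with hlt | hlt
      · have : HasLow (K.boundary F c) k' := by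
          rw [hsplit]
          exact ⟨by rw [Pi.add_apply, hk''.2 _ hlt, zero_add]; exact hav.1, fun i hi => by
            rw [Pi.add_apply, hk''.2 _ (hlt.trans hi), hav.2 _ hi, zero_add]⟩
        rw [hk.unique this]
        exact ⟨_, Nat.lt_succ_self n, hk'⟩
      · have : HasLow (K.boundary F c) k'' := by
          rw [hsplit]
          exact ⟨by rw [Pi.add_apply, hav.2 _ hlt, add_zero]; exact hk''.1, fun i hi => by
            rw [Pi.add_apply, hav.2 _ (hlt.trans hi), hk''.2 _ hi, zero_add]⟩
        rw [hk.unique this]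
        exact ⟨j, by omega, hpj⟩
    · obtain ⟨j, hj, h⟩ := ih _ (hred v hv) k (by simpa [hv0] using hk)
      exact ⟨j, by omega, h⟩

/-- The reduced form of column `j` is minimal: no chain with last simplex `j` has a boundary with
a smaller lowest index. -/
theorem le_of_hasLow_boundary {k k' j : Fin m} (h : pair k j) {z : Fin m → F} (hz : HasLow z j)
    (hk' : K.boundary F z = 0 ∨ HasLow (K.boundary F z) k' ∧ k' < k) : False := by
  obtain ⟨v, hv, hvk⟩ := hp.cert h
  have hmem : v - (v j / z j) • z ∈ K.chains F j := by
    intro i hi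
    rcases hi.eq_or_lt with he | hlt
    · obtain rfl : i = j := Fin.ext he.symm
      simp [div_mul_cancel₀ _ hz.1]
    · simp [hv.2 i hlt, hz.2 i hlt]
  have hlow : HasLow (K.boundary F (v - (v j / z j) • z)) k := by
    rcases hk' with h0 | ⟨hk', hlt⟩
    · simpa [h0] using hvk
    · exact ⟨by simpa [hk'.2 k hlt] using hvk.1, fun i hi => by
        simp [hk'.2 i (hlt.trans hi), hvk.2 i hi]⟩
  obtain ⟨j', hj', hpj'⟩ := hp.exists_pair_of_hasLow_boundary _ _ hmem k hlow
  rw [hp.inj h hpj'] at hj'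
  exact lt_irrefl _ hj'

theorem unique_left {k k' j : Fin m} (h : pair k j) (h' : pair k' j) : k = k' := by
  rcases lt_trichotomy k k' with hlt | he | hlt
  · obtain ⟨v, hv, hvk⟩ := hp.cert h
    exact (hp.le_of_hasLow_boundary h' hv (Or.inr ⟨hvk, hlt⟩)).elim
  · exact he
  · obtain ⟨v, hv, hvk⟩ := hp.cert h'
    exact (hp.le_of_hasLow_boundary h hv (Or.inr ⟨hvk, hlt⟩)).elim

theorem not_pair_of_pair {k j j' : Fin m} (h : pair j j') : ¬ pair k j := fun h' => by
  obtain ⟨v, _, hvk⟩ := hp.cert h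
  exact hp.le_of_hasLow_boundary (k' := k) h' hvk (Or.inl (K.boundary_boundary F v))

theorem lt {k j : Fin m} (h : pair k j) : k < j := by
  obtain ⟨v, hv, hvk⟩ := hp.cert h
  exact K.lt_of_hasLow_boundary hv hvk

open Classical in
theorem finrank_cycles (a : ℕ) : Module.finrank F (K.cycles F a) =
    (Finset.univ.filter (fun i : Fin m => (i : ℕ) < a ∧ ¬ ∃ k, pair k i)).card := by
  refine finrank_eq_card_of_hasLow _ _ ?_ ?_
  · intro i hi
    simp only [Finset.mem_filter, Finset.mem_univ, true_and] at hi
    obtain ⟨v, hv, hv0⟩ := (hp.total i).resolve_left hi.2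
    exact ⟨v, ⟨fun l hl => hv.2 l (hi.1.trans_le hl), hv0⟩, hv⟩
  · intro z hz i hi
    simp only [Finset.mem_filter, Finset.mem_univ, true_and]
    refine ⟨not_le.1 fun h => hi.1 (hz.1 i h), fun ⟨k, hk⟩ => ?_⟩
    exact hp.le_of_hasLow_boundary (k' := k) hk hi (Or.inl hz.2)

open Classical in
theorem finrank_chains_inf_boundaries (a b : ℕ) :
    Module.finrank F ↥(K.chains F a ⊓ K.boundaries F b) =
    (Finset.univ.filter
      (fun i : Fin m => (i : ℕ) < a ∧ ∃ j : Fin m, (j : ℕ) < b ∧ pair i j)).card := by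
  refine finrank_eq_card_of_hasLow _ _ ?_ ?_
  · intro i hi
    simp only [Finset.mem_filter, Finset.mem_univ, true_and] at hi
    obtain ⟨hia, j, hj, hij⟩ := hi
    obtain ⟨v, hv, hvi⟩ := hp.cert hij
    exact ⟨_, ⟨fun l hl => hvi.2 l (hia.trans_le hl),
      ⟨v, fun l hl => hv.2 l (hj.trans_le hl), rfl⟩⟩, hvi⟩
  · rintro _ ⟨hz, ⟨c, hc, rfl⟩⟩ i hi
    simp only [Finset.mem_filter, Finset.mem_univ, true_and]
    exact ⟨not_le.1 fun h => hi.1 (hz i h), hp.exists_pair_of_hasLow_boundary b c hc i hi⟩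

end FilteredComplex.IsPairing

theorem FilteredComplex.boundaries_le_ker (F : Type) [Field F] (b : ℕ) :
    K.boundaries F b ≤ LinearMap.ker (K.boundary F) := by
  rintro _ ⟨c, _, rfl⟩
  exact K.boundary_boundary F c

theorem FilteredComplex.persistentBetti_add_finrank (F : Type) [Field F] {a b : ℕ} (h : a ≤ b) :
    K.persistentBetti F a b + Module.finrank F ↥(K.chains F a ⊓ K.boundaries F b) =
      Module.finrank F (K.cycles F a) := by
  rw [persistentBetti, dif_pos h]
  set p := (K.boundaries F a).comap (K.cycles F a).subtype
  set p' := (K.boundaries F b).comap (K.cycles F b).subtype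
  set ι := Submodule.inclusion (K.cycles_mono F h)
  have hrange : LinearMap.range (K.homologyMap F h) = LinearMap.range (p'.mkQ ∘ₗ ι) := by
    have : K.homologyMap F h ∘ₗ p.mkQ = p'.mkQ ∘ₗ ι := LinearMap.ext fun _ => rfl
    rw [← this, LinearMap.range_comp, Submodule.range_mkQ, Submodule.map_top]
  have hker : Module.finrank F (LinearMap.ker (p'.mkQ ∘ₗ ι)) =
      Module.finrank F ↥(K.chains F a ⊓ K.boundaries F b) := by
    have : LinearMap.ker (p'.mkQ ∘ₗ ι) =
        (K.chains F a ⊓ K.boundaries F b).comap (K.cycles F a).subtype := by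
      ext z
      simp only [LinearMap.mem_ker, LinearMap.comp_apply, Submodule.mkQ_apply,
        Submodule.Quotient.mk_eq_zero, p', Submodule.mem_comap, Submodule.mem_inf]
      exact ⟨fun hz => ⟨z.2.1, hz⟩, fun hz => hz.2⟩
    rw [this]
    exact (Submodule.comapSubtypeEquivOfLe
      (le_inf inf_le_left (inf_le_right.trans (K.boundaries_le_ker F b)))).finrank_eq
  rw [hrange, ← hker, LinearMap.finrank_range_add_finrank_ker]

namespace FilteredComplex.IsPairing

variable {K} {pair : Fin m → Fin m → Prop} (hp : K.IsPairing F pair)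
include hp

open Classical in
/-- The number of intervals born with `i` and alive at `b`. -/
theorem persistentBetti_succ_sub (i : Fin m) {b : ℕ} (hb : (i : ℕ) + 1 ≤ b) :
    (K.persistentBetti F (i + 1) b : ℤ) - K.persistentBetti F i b =
      (if ∃ k, pair k i then 0 else 1) -
        (if ∃ j : Fin m, (j : ℕ) < b ∧ pair i j then 1 else 0) := by
  have hstep : ∀ (p : Fin m → Prop) [DecidablePred p],
      ((Finset.univ.filter (fun l : Fin m => (l : ℕ) < i + 1 ∧ p l)).card : ℤ) =
        (Finset.univ.filter (fun l : Fin m => (l : ℕ) < i ∧ p l)).card +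
          if p i then 1 else 0 := by
    intro p _
    by_cases hpi : p i
    · rw [if_pos hpi]
      have : (Finset.univ.filter (fun l : Fin m => (l : ℕ) < i + 1 ∧ p l)) =
          insert i (Finset.univ.filter (fun l : Fin m => (l : ℕ) < i ∧ p l)) := by
        ext l
        simp only [Finset.mem_filter, Finset.mem_univ, true_and, Finset.mem_insert]
        constructor
        · rintro ⟨h₁, h₂⟩
          rcases (Nat.lt_succ_iff.1 h₁).eq_or_lt with h | h
          · exact Or.inl (Fin.ext h)
          · exact Or.inr ⟨h, h₂⟩
        · rintro (rfl | ⟨h₁, h₂⟩)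
          · exact ⟨Nat.lt_succ_self _, hpi⟩
          · exact ⟨by omega, h₂⟩
      rw [this, Finset.card_insert_of_notMem (by simp)]
      push_cast
      ring
    · rw [if_neg hpi, add_zero]
      congr 2
      ext l
      simp only [Finset.mem_filter, Finset.mem_univ, true_and]
      constructor
      · rintro ⟨h₁, h₂⟩
        rcases (Nat.lt_succ_iff.1 h₁).eq_or_lt with h | h
        · exact absurd (Fin.ext h ▸ h₂) hpi
        · exact ⟨h, h₂⟩
      · rintro ⟨h₁, h₂⟩
        exact ⟨by omega, h₂⟩
  have h₁ := K.persistentBetti_add_finrank F hb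
  have h₂ := K.persistentBetti_add_finrank F (a := i) (b := b) (by omega)
  rw [hp.finrank_cycles, hp.finrank_chains_inf_boundaries] at h₁ h₂
  replace h₁ := congrArg (Nat.cast (R := ℤ)) h₁
  replace h₂ := congrArg (Nat.cast (R := ℤ)) h₂
  rw [Nat.cast_add] at h₁ h₂
  rw [hstep (fun i => ∃ j : Fin m, (j : ℕ) < b ∧ pair i j), hstep (fun i => ¬ ∃ k, pair k i)] at h₁
  have : (if ¬ ∃ k, pair k i then (1 : ℤ) else 0) = if ∃ k, pair k i then 0 else 1 :=
    ite_not _ _ _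
  rw [this] at h₁
  linarith

theorem mem_diagram_coe (i j : Fin m) :
    (i, (j : WithTop (Fin m))) ∈ K.diagram F ↔ pair i j := by
  classical
  simp only [diagram, Finset.mem_filter, Finset.mem_univ, true_and]
  change 0 < (if i < j then _ else (0 : ℤ)) ↔ _
  split_ifs with hij
  · rw [hp.persistentBetti_succ_sub i (b := j) hij,
      hp.persistentBetti_succ_sub i (b := j + 1) (by have : (i : ℕ) < j := hij; omega)]
    by_cases h : pair i j
    · have h₁ : ∃ j' : Fin m, (j' : ℕ) < j + 1 ∧ pair i j' := ⟨j, Nat.lt_succ_self _, h⟩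
      have h₂ : ¬ ∃ j' : Fin m, (j' : ℕ) < j ∧ pair i j' := fun ⟨j', hlt, h'⟩ => by
        rw [hp.inj h h'] at hlt
        exact lt_irrefl _ hlt
      rw [if_pos h₁, if_neg h₂]
      simp [h]
    · have : (∃ j' : Fin m, (j' : ℕ) < j + 1 ∧ pair i j') ↔
          ∃ j' : Fin m, (j' : ℕ) < j ∧ pair i j' := by
        constructor
        · rintro ⟨j', hlt, h'⟩
          rcases (Nat.lt_succ_iff.1 hlt).eq_or_lt with he | hlt
          · exact absurd (Fin.ext he ▸ h') h
          · exact ⟨j', hlt, h'⟩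
        · rintro ⟨j', hlt, h'⟩
          exact ⟨j', by omega, h'⟩
      simp only [this, h]
      simp
  · exact ⟨fun h => absurd h (lt_irrefl _), fun h => absurd (hp.lt h) hij⟩

theorem mem_diagram_top (i : Fin m) :
    (i, (⊤ : WithTop (Fin m))) ∈ K.diagram F ↔ (¬ ∃ k, pair k i) ∧ ¬ ∃ j, pair i j := by
  classical
  simp only [diagram, Finset.mem_filter, Finset.mem_univ, true_and]
  change 0 < (K.persistentBetti F (i + 1) m : ℤ) - K.persistentBetti F i m ↔ _
  rw [hp.persistentBetti_succ_sub i (b := m) i.2]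
  have : (∃ j : Fin m, (j : ℕ) < m ∧ pair i j) ↔ ∃ j, pair i j :=
    ⟨fun ⟨j, _, h⟩ => ⟨j, h⟩, fun ⟨j, h⟩ => ⟨j, j.2, h⟩⟩
  simp only [this]
  by_cases h₁ : ∃ k, pair k i <;> by_cases h₂ : ∃ j, pair i j <;> simp [h₁, h₂]

end FilteredComplex.IsPairing

end Pairing

/-! ### Operation counts -/

/-- The total number of operations, of any kind. -/
def OpCount.total (c : OpCount) : ℕ := c.add + c.mul + c.div + c.mem

/-- The total number of operations spent on a value. -/
def Counted.cost {α : Type} (x : Counted α) : ℕ := x.ops.total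

theorem OpCount.time_le (c : OpCount) {tAdd tMul tDiv tMem A : ℝ} (h₁ : tAdd ≤ A)
    (h₂ : tMul ≤ A) (h₃ : tDiv ≤ A) (h₄ : tMem ≤ A) :
    c.time tAdd tMul tDiv tMem ≤ A * c.total := by
  have e₁ := mul_le_mul_of_nonneg_left h₁ (Nat.cast_nonneg (α := ℝ) c.add)
  have e₂ := mul_le_mul_of_nonneg_left h₂ (Nat.cast_nonneg (α := ℝ) c.mul)
  have e₃ := mul_le_mul_of_nonneg_left h₃ (Nat.cast_nonneg (α := ℝ) c.div)
  have e₄ := mul_le_mul_of_nonneg_left h₄ (Nat.cast_nonneg (α := ℝ) c.mem)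
  simp only [time, total]
  push_cast
  linarith

section Counted

variable {α β : Type}

@[simp] theorem Counted.val_bind (x : Counted α) (f : α → Counted β) :
    (x >>= f).val = (f x.val).val := rfl

@[simp] theorem Counted.cost_bind (x : Counted α) (f : α → Counted β) :
    (x >>= f).cost = x.cost + (f x.val).cost := by
  simp only [cost, OpCount.total, bind]
  ring

@[simp] theorem Counted.val_pure (a : α) : (pure a : Counted α).val = a := rfl

@[simp] theorem Counted.cost_pure (a : α) : (pure a : Counted α).cost = 0 := rfl

@[simp] theorem cost_tick (c : OpCount) : (tick c).cost = c.total := rfl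

end Counted

/-! ### Products of sets of primes and the projections of `ℤ/Q` -/

/-- The numbers `q s` are distinct primes with product `Q`. -/
structure IsPrimeFamily {r : ℕ} (q : Fin r → ℕ) (Q : ℕ) : Prop where
  prime : ∀ s, (q s).Prime
  injective : Function.Injective q
  prod_eq : ∏ s, q s = Q

/-- The product of the primes `q s` with `s ∈ S`. -/
def primeProd {r : ℕ} (q : Fin r → ℕ) (S : Finset (Fin r)) : ℕ := ∏ s ∈ S, q s

theorem cost_crtSum_le (Q QT : ℕ) (l : List ℕ) :
    (crtSum Q QT l).cost ≤ 6 * l.length := by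
  induction l with
  | nil => simp [crtSum]
  | cons t l ih =>
    rw [crtSum]
    simp only [Counted.cost_bind, cost_tick, OpCount.total, List.length_cons]
    split_ifs <;> simp only [Counted.cost_bind, cost_tick, OpCount.total, Counted.cost_pure] <;>
      omega

theorem cost_partialIdentity_le (Q QT : ℕ) (l : List ℕ) :
    (partialIdentity Q l QT).cost ≤ 1 + if QT = Q then 0 else 6 * l.length := by
  rw [partialIdentity]
  simp only [Counted.cost_bind, cost_tick, OpCount.total]
  split_ifs with hT
  · simp
  · have := cost_crtSum_le Q QT l
    omega

namespace IsPrimeFamily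

variable {r : ℕ} {q : Fin r → ℕ} {Q : ℕ} (h : IsPrimeFamily q Q)
include h

theorem coprime {s t : Fin r} (hne : s ≠ t) : (q s).Coprime (q t) :=
  (Nat.coprime_primes (h.prime s) (h.prime t)).2 fun he => hne (h.injective he)

theorem dvd_primeProd_iff {s : Fin r} {S : Finset (Fin r)} : q s ∣ primeProd q S ↔ s ∈ S := by
  rw [primeProd, (h.prime s).prime.dvd_finsetProd_iff]
  constructor
  · rintro ⟨t, ht, hd⟩
    rwa [h.injective ((Nat.prime_dvd_prime_iff_eq (h.prime s) (h.prime t)).1 hd)]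
  · exact fun hs => ⟨s, hs, dvd_rfl⟩

theorem primeProd_dvd_iff {S : Finset (Fin r)} {n : ℕ} :
    primeProd q S ∣ n ↔ ∀ s ∈ S, q s ∣ n := by
  constructor
  · exact fun hd s hs => (h.dvd_primeProd_iff.2 hs).trans hd
  · intro hd
    exact Finset.prod_dvd_of_isRelPrime
      (fun s _ t _ hne => Nat.coprime_iff_isRelPrime.1 (h.coprime hne)) hd

theorem primeProd_injective : Function.Injective (primeProd q) := fun S T he => by
  ext s
  rw [← h.dvd_primeProd_iff, he, h.dvd_primeProd_iff]

theorem primeProd_univ : primeProd q Finset.univ = Q := h.prod_eq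

theorem primeProd_eq_one_iff {S : Finset (Fin r)} : primeProd q S = 1 ↔ S = ∅ :=
  ⟨fun he => h.primeProd_injective (he.trans (Finset.prod_empty).symm),
    fun he => he ▸ Finset.prod_empty⟩

theorem primeProd_eq_iff {S : Finset (Fin r)} : primeProd q S = Q ↔ S = Finset.univ :=
  ⟨fun he => h.primeProd_injective (he.trans h.primeProd_univ.symm),
    fun he => he ▸ h.primeProd_univ⟩

theorem primeProd_pos (S : Finset (Fin r)) : 0 < primeProd q S :=
  Finset.prod_pos fun s _ => (h.prime s).pos

theorem one_lt_primeProd_iff {S : Finset (Fin r)} : 1 < primeProd q S ↔ S.Nonempty := by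
  rw [Finset.nonempty_iff_ne_empty, Ne, ← h.primeProd_eq_one_iff]
  have := h.primeProd_pos S
  omega

theorem gcd_primeProd (n : ℕ) (S : Finset (Fin r)) :
    Nat.gcd n (primeProd q S) = primeProd q (S.filter (fun s => q s ∣ n)) := by
  induction S using Finset.induction_on with
  | empty => simp [primeProd]
  | insert s S hs ih =>
    have hcop : (q s).Coprime (primeProd q S) :=
      ((h.prime s).coprime_iff_not_dvd).2 fun hd => hs (h.dvd_primeProd_iff.1 hd)
    have hins : primeProd q (insert s S) = q s * primeProd q S := Finset.prod_insert hs
    rw [hins, hcop.gcd_mul, ih, Finset.filter_insert]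
    split_ifs with hd
    · rw [Nat.gcd_eq_right hd, primeProd, primeProd,
        Finset.prod_insert fun hm => hs (Finset.mem_filter.1 hm).1]
    · rw [((h.prime s).coprime_iff_not_dvd.2 hd).symm.gcd_eq_one, one_mul]

theorem gcd_primeProd_primeProd (T S : Finset (Fin r)) :
    Nat.gcd (primeProd q T) (primeProd q S) = primeProd q (S ∩ T) := by
  rw [h.gcd_primeProd]
  congr 1
  ext s
  rw [Finset.mem_filter, h.dvd_primeProd_iff, Finset.mem_inter]

theorem primeProd_div {S T : Finset (Fin r)} (hT : T ⊆ S) :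
    primeProd q S / primeProd q T = primeProd q (S \ T) :=
  Nat.div_eq_of_eq_mul_left (h.primeProd_pos T) (Finset.prod_sdiff hT).symm

theorem coprime_primeProd_iff {S T : Finset (Fin r)} :
    (primeProd q S).Coprime (primeProd q T) ↔ Disjoint S T := by
  rw [Nat.coprime_iff_gcd_eq_one, h.gcd_primeProd_primeProd, h.primeProd_eq_one_iff,
    ← Finset.disjoint_iff_inter_eq_empty, disjoint_comm]

theorem dvd (s : Fin r) : q s ∣ Q :=
  h.prod_eq ▸ Finset.dvd_prod_of_mem q (Finset.mem_univ s)

theorem ne_zero : NeZero Q :=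
  ⟨h.primeProd_univ ▸ (h.primeProd_pos Finset.univ).ne'⟩

omit h in
/-- Reduction of the coefficients modulo the prime `q s`. -/
def proj (h : IsPrimeFamily q Q) (s : Fin r) : ZMod Q →+* ZMod (q s) :=
  ZMod.castHom (h.dvd s) (ZMod (q s))

theorem dvd_val_iff {s : Fin r} {x : ZMod Q} : q s ∣ x.val ↔ h.proj s x = 0 := by
  have := h.ne_zero
  conv_rhs => rw [← ZMod.natCast_zmod_val x, map_natCast]
  rw [ZMod.natCast_eq_zero_iff]

theorem primeProd_dvd_val_iff {S : Finset (Fin r)} {x : ZMod Q} :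
    primeProd q S ∣ x.val ↔ ∀ s ∈ S, h.proj s x = 0 := by
  rw [h.primeProd_dvd_iff]
  exact forall₂_congr fun s _ => h.dvd_val_iff

theorem eq_zero_of_proj {x : ZMod Q} (hx : ∀ s, h.proj s x = 0) : x = 0 := by
  have := h.ne_zero
  have hd : Q ∣ x.val := by
    have hd : primeProd q Finset.univ ∣ x.val := h.primeProd_dvd_val_iff.2 fun s _ => hx s
    rwa [h.primeProd_univ] at hd
  rw [← ZMod.val_eq_zero]
  exact Nat.eq_zero_of_dvd_of_lt hd (ZMod.val_lt x)

theorem gcd_val_primeProd [∀ s, DecidableEq (ZMod (q s))] (x : ZMod Q) (S : Finset (Fin r)) :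
    Nat.gcd x.val (primeProd q S) = primeProd q (S.filter (fun s => h.proj s x = 0)) := by
  rw [h.gcd_primeProd]
  congr 1
  exact Finset.filter_congr fun s _ => h.dvd_val_iff

/-! ### Partial inverses -/

theorem proj_gcdA {s : Fin r} {a b : ℕ} (hb : q s ∣ b) :
    (a : ZMod (q s)) * h.proj s ((Nat.gcdA a b : ℤ) : ZMod Q) = (Nat.gcd a b : ZMod (q s)) := by
  have := congrArg (Int.cast : ℤ → ZMod (q s)) (Nat.gcd_eq_gcd_ab a b)
  push_cast at this
  rw [this, (ZMod.natCast_eq_zero_iff b (q s)).2 hb, zero_mul, add_zero, map_intCast]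

theorem proj_crtSum (s : Fin r) (T : Finset (Fin r)) (l : List (Fin r)) (hl : l.Nodup) :
    h.proj s (crtSum Q (primeProd q T) (l.map q)).val = if s ∈ l ∧ s ∈ T then 1 else 0 := by
  induction l with
  | nil => simp [crtSum]
  | cons t l ih =>
    have ih := ih (List.nodup_cons.1 hl).2
    have ht := (List.nodup_cons.1 hl).1
    have hterm : h.proj s (((Q / q t : ℕ) : ZMod Q) *
        ((Nat.gcdA (Q / q t) (q t) : ℤ) : ZMod Q)) = if s = t then 1 else 0 := by
      rw [map_mul, map_natCast]
      have hQ : Q / q t = primeProd q (Finset.univ.erase t) := by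
        rw [← h.primeProd_univ]
        exact Nat.div_eq_of_eq_mul_left (h.prime t).pos
          (Finset.prod_erase_mul _ _ (Finset.mem_univ t)).symm
      by_cases hst : s = t
      · subst hst
        rw [h.proj_gcdA dvd_rfl, if_pos rfl]
        have : (Q / q s).Coprime (q s) := by
          rw [Nat.coprime_comm, (h.prime s).coprime_iff_not_dvd, hQ, h.dvd_primeProd_iff]
          simp
        rw [this.gcd_eq_one, Nat.cast_one]
      · rw [if_neg hst, (ZMod.natCast_eq_zero_iff _ _).2, zero_mul]
        rw [hQ, h.dvd_primeProd_iff]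
        simp [hst]
    rw [List.map_cons, crtSum]
    simp only [Counted.val_bind]
    split_ifs with hd hs hs <;> rw [h.dvd_primeProd_iff] at hd <;>
      simp only [Counted.val_bind, Counted.val_pure, map_add, hterm, ih, List.mem_cons] at hs ⊢
    · by_cases hst : s = t
      · subst hst; simp [ht]
      · simp [hst, (hs.1.resolve_left hst), hs.2]
    · by_cases hst : s = t
      · subst hst; exact absurd ⟨Or.inl rfl, hd⟩ hs
      · rw [if_neg hst, if_neg fun hc => hs ⟨Or.inr hc.1, hc.2⟩, add_zero]
    · rw [if_pos ⟨hs.1.resolve_left fun he => hd (he ▸ hs.2), hs.2⟩]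
    · rw [if_neg fun hc => hs ⟨Or.inr hc.1, hc.2⟩]

theorem proj_partialIdentity (s : Fin r) (T : Finset (Fin r)) :
    h.proj s (partialIdentity Q (List.ofFn q) (primeProd q T)).val = if s ∈ T then 1 else 0 := by
  rw [partialIdentity]
  simp only [Counted.val_bind]
  split_ifs with hT hs hs
  · simp
  · rw [h.primeProd_eq_iff] at hT
    simp [hT] at hs
  · rw [List.ofFn_eq_map, h.proj_crtSum s T _ (List.nodup_finRange r)]
    simp [hs]
  · rw [List.ofFn_eq_map, h.proj_crtSum s T _ (List.nodup_finRange r)]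
    simp [hs]

theorem partialInverse_eq {x : ZMod Q} {T : Finset (Fin r)} (hx : ∀ s ∈ T, h.proj s x ≠ 0) :
    primeProd q T / Nat.gcd x.val (primeProd q T) = primeProd q T := by
  classical
  rw [h.gcd_val_primeProd, Finset.filter_false_of_mem hx]
  exact Nat.div_one _

theorem proj_partialInverse {x : ZMod Q} {T : Finset (Fin r)} (hx : ∀ s ∈ T, h.proj s x ≠ 0)
    (s : Fin r) :
    h.proj s x * h.proj s (partialInverse Q (List.ofFn q) x (primeProd q T)).val =
      if s ∈ T then 1 else 0 := by
  classical
  have := h.ne_zero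
  rw [partialInverse]
  simp only [Counted.val_bind, Counted.val_pure, h.partialInverse_eq hx, map_mul,
    h.proj_partialIdentity]
  split_ifs with hs
  · rw [mul_one]
    conv_lhs => rw [← ZMod.natCast_zmod_val x, map_natCast]
    rw [ZMod.natCast_zmod_val, h.proj_gcdA (h.dvd_primeProd_iff.2 hs), h.gcd_val_primeProd,
      Finset.filter_false_of_mem hx]
    simp [primeProd]
  · simp

theorem proj_partialInverse_of_notMem {x : ZMod Q} {T : Finset (Fin r)}
    (hx : ∀ s ∈ T, h.proj s x ≠ 0) {s : Fin r} (hs : s ∉ T) :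
    h.proj s (partialInverse Q (List.ofFn q) x (primeProd q T)).val = 0 := by
  rw [partialInverse]
  simp only [Counted.val_bind, Counted.val_pure, h.partialInverse_eq hx, map_mul,
    h.proj_partialIdentity, if_neg hs, mul_zero]

theorem cost_partialInverse_le {x : ZMod Q} {T : Finset (Fin r)}
    (hx : ∀ s ∈ T, h.proj s x ≠ 0) :
    (partialInverse Q (List.ofFn q) x (primeProd q T)).cost ≤
      5 + if primeProd q T = Q then 0 else 6 * r := by
  rw [partialInverse]
  simp only [Counted.cost_bind, cost_tick, OpCount.total, Counted.cost_pure,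
    h.partialInverse_eq hx]
  have := cost_partialIdentity_le Q (primeProd q T) (List.ofFn q)
  rw [List.length_ofFn] at this
  omega

end IsPrimeFamily

/-! ### Partially reduced columns -/

section Reduction

variable {m r : ℕ} {q : Fin r → ℕ} {Q : ℕ} (K : FilteredComplex m) (h : IsPrimeFamily q Q)

/-- The boundary of a chain meets at most `D` rows for each simplex of the chain. -/
theorem nnz_boundary_le {D : ℕ} (hD : ∀ j, (K.simplex j).card ≤ D) (v : Fin m → ZMod Q)
    (I : Finset (Fin m)) (hv : ∀ l, v l ≠ 0 → l ∈ I) :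
    nnz (K.boundary (ZMod Q) v) ≤ D * I.card := by
  rw [nnz, mul_comm]
  refine le_trans (Finset.card_le_card (t := I.biUnion fun l =>
    Finset.univ.filter (fun i => K.boundaryMatrix (ZMod Q) i l ≠ 0)) fun i hi => ?_)
    (Finset.card_biUnion_le_card_mul _ _ _ fun l _ =>
      (K.card_filter_boundaryMatrix_ne_zero_le _ l).trans (hD l))
  have hi := (Finset.mem_filter.1 hi).2
  rw [K.boundary_apply] at hi
  obtain ⟨l, _, hl⟩ := Finset.exists_ne_zero_of_sum_ne_zero hi
  exact Finset.mem_biUnion.2 ⟨l, hv l (right_ne_zero_of_mul hl),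
    Finset.mem_filter.2 ⟨Finset.mem_univ i, left_ne_zero_of_mul hl⟩⟩

theorem FilteredComplex.map_boundary {R R' : Type} [CommRing R] [CommRing R'] (f : R →+* R')
    (v : Fin m → R) (i : Fin m) :
    f (K.boundary R v i) = K.boundary R' (fun l => f (v l)) i := by
  simp [FilteredComplex.boundary_apply, K.map_boundaryMatrix]

/-- The column `c` is a form of column `j`, partially reduced modulo the primes in `S`: it is the
boundary of a chain of simplices of the dimension of `σ_j` with indices in `[lo, j]`, in which
`σ_j` itself has a coefficient that is a unit modulo the primes in `S`. -/
def IsReduction (lo : ℕ) (j : Fin m) (S : Finset (Fin r)) (c : Fin m → ZMod Q) : Prop :=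
  ∃ v : Fin m → ZMod Q, c = K.boundary (ZMod Q) v ∧
    (∀ l, v l ≠ 0 → lo ≤ (l : ℕ) ∧ l ≤ j ∧ (K.simplex l).card = (K.simplex j).card) ∧
    ∀ s ∈ S, h.proj s (v j) ≠ 0

variable {K h} {lo : ℕ} {j : Fin m} {S : Finset (Fin r)} {c : Fin m → ZMod Q}

theorem IsReduction.mono (hc : IsReduction K h lo j S c) {lo' : ℕ} (hlo : lo' ≤ lo)
    {S' : Finset (Fin r)} (hS : S' ⊆ S) : IsReduction K h lo' j S' c := by
  obtain ⟨v, hv, hsupp, hu⟩ := hc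
  exact ⟨v, hv, fun l hl => ⟨hlo.trans (hsupp l hl).1, (hsupp l hl).2⟩, fun s hs => hu s (hS hs)⟩

theorem IsReduction.nnz_le (hc : IsReduction K h lo j S c) {D : ℕ}
    (hD : ∀ j, (K.simplex j).card ≤ D) : nnz c ≤ D * (j + 1 - lo) := by
  obtain ⟨v, rfl, hsupp, _⟩ := hc
  refine (nnz_boundary_le K hD v (Finset.univ.filter (fun l : Fin m => lo ≤ (l : ℕ) ∧ l ≤ j))
    fun l hl => Finset.mem_filter.2
      ⟨Finset.mem_univ l, (hsupp l hl).1, (hsupp l hl).2.1⟩).trans ?_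
  refine Nat.mul_le_mul_left D ?_
  calc _ ≤ (Finset.Ico lo (j + 1)).card :=
        Finset.card_le_card_of_injOn (fun l : Fin m => (l : ℕ)) (fun l hl => by
          have := (Finset.mem_filter.1 hl).2
          exact Finset.mem_coe.2 (Finset.mem_Ico.2 ⟨this.1, Nat.lt_succ_of_le this.2⟩))
          (fun a _ b _ hab => Fin.ext hab)
    _ = _ := Nat.card_Ico _ _

theorem IsReduction.card_add_one (hc : IsReduction K h lo j S c) {i : Fin m} (hi : c i ≠ 0) :
    (K.simplex i).card + 1 = (K.simplex j).card := by
  obtain ⟨v, rfl, hsupp, _⟩ := hc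
  rw [K.boundary_apply] at hi
  obtain ⟨l, _, hl⟩ := Finset.exists_ne_zero_of_sum_ne_zero hi
  rw [← (hsupp l (right_ne_zero_of_mul hl)).2.2]
  exact K.card_add_one_of_boundaryMatrix_ne_zero _ (left_ne_zero_of_mul hl)

theorem IsReduction.sub_smul (hc : IsReduction K h lo j S c) {j' : Fin m} (hlt : j' < j)
    (hcard : (K.simplex j').card = (K.simplex j).card) {T : Finset (Fin r)}
    {c' : Fin m → ZMod Q} (hc' : IsReduction K h lo j' T c') (a : ZMod Q) :
    IsReduction K h lo j S (c - a • c') := by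
  obtain ⟨v, rfl, hsupp, hu⟩ := hc
  obtain ⟨v', rfl, hsupp', _⟩ := hc'
  refine ⟨v - a • v', by simp, fun l hl => ?_, fun s hs => ?_⟩
  · by_cases hvl : v l = 0
    · have : v' l ≠ 0 := fun h0 => hl (by simp [hvl, h0])
      exact ⟨(hsupp' l this).1, (hsupp' l this).2.1.trans hlt.le, (hsupp' l this).2.2.trans hcard⟩
    · exact hsupp l hvl
  · have : v' j = 0 := by_contra fun h0 => absurd (hsupp' j h0).2.1 (not_le.2 hlt)
    simpa [this] using hu s hs

theorem IsReduction.smul (hc : IsReduction K h lo j S c) {a : ZMod Q} {S' : Finset (Fin r)}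
    (hS : S' ⊆ S) (ha : ∀ s ∈ S', h.proj s a ≠ 0) (hp : ∀ s, (q s).Prime) :
    IsReduction K h lo j S' (a • c) := by
  obtain ⟨v, rfl, hsupp, hu⟩ := hc
  refine ⟨a • v, by simp, fun l hl => hsupp l fun h0 => hl (by simp [h0]), fun s hs => ?_⟩
  have : Fact (q s).Prime := ⟨hp s⟩
  rw [Pi.smul_apply, smul_eq_mul, map_mul]
  exact mul_ne_zero (ha s hs) (hu s (hS hs))

variable (K h)

/-- The entry `e` of the index table at row `k` is the reduced form of its column modulo the primes
in `T`, normalized so that its lowest coefficient is `1`; modulo the other primes it vanishes. -/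
structure IsEntry (k : Fin m) (e : Entry m Q) (T : Finset (Fin r)) : Prop where
  QT_eq : e.QT = primeProd q T
  nonempty : T.Nonempty
  off : ∀ s ∉ T, ∀ i, h.proj s (e.vec i) = 0
  one : ∀ s ∈ T, h.proj s (e.vec k) = 1
  above : ∀ i, k < i → e.vec i = 0
  red : IsReduction K h (k + 1) e.column T e.vec

/-- The column `c` during the reduction at row `k` of column `j`, modulo the primes in `S`; its
coefficient at `k` is still to be removed modulo the primes in `U`. -/
structure IsRowState (k j : Fin m) (S U : Finset (Fin r)) (c : Fin m → ZMod Q) : Prop where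
  above : ∀ i, k < i → c i = 0
  red : IsReduction K h (k + 1) j S c
  off : ∀ s ∉ S, ∀ i, h.proj s (c i) = 0
  subset : U ⊆ S
  mem_iff : ∀ s, s ∈ U ↔ h.proj s (c k) ≠ 0

/-- The column `c` between two rounds of the reduction of column `j`, modulo the primes in `S`:
the rows from `b` on are reduced to zero. -/
structure IsColumnState (b : ℕ) (j : Fin m) (S : Finset (Fin r)) (c : Fin m → ZMod Q) :
    Prop where
  above : ∀ i : Fin m, b ≤ i → c i = 0
  red : IsReduction K h b j S c
  off : ∀ s ∉ S, ∀ i, h.proj s (c i) = 0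

variable {K h}

theorem IsEntry.card_add_one {k : Fin m} {e : Entry m Q} {T : Finset (Fin r)}
    (he : IsEntry K h k e T) : (K.simplex k).card + 1 = (K.simplex e.column).card := by
  obtain ⟨s, hs⟩ := he.nonempty
  refine he.red.card_add_one fun h0 => ?_
  have : Fact (q s).Prime := ⟨h.prime s⟩
  have h1 := he.one s hs
  rw [h0, map_zero] at h1
  exact zero_ne_one h1

theorem IsEntry.lt {k : Fin m} {e : Entry m Q} {T : Finset (Fin r)}
    (he : IsEntry K h k e T) : k < e.column := by
  obtain ⟨s, hs⟩ := he.nonempty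
  obtain ⟨v, _, hsupp, hu⟩ := he.red
  exact (hsupp e.column fun h0 => hu s hs (by rw [h0, map_zero])).1

/-- One column operation of the inner loop, with the column of an entry for the primes in `T`. -/
theorem IsRowState.subMul {k j : Fin m} {S U T : Finset (Fin r)} {c : Fin m → ZMod Q}
    (hc : IsRowState K h k j S U c) {e : Entry m Q} (he : IsEntry K h k e T)
    (hlt : e.column < j) (hcard : (K.simplex e.column).card = (K.simplex j).card) :
    IsRowState K h k j S (U \ T) (c - c k • e.vec) := by
  have hck : ∀ s ∉ U, h.proj s (c k) = 0 := fun s hs =>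
    by_contra fun hne => hs ((hc.mem_iff s).2 hne)
  refine ⟨fun i hi => ?_, hc.red.sub_smul hlt hcard he.red _, fun s hs i => ?_,
    Finset.sdiff_subset.trans hc.subset, fun s => ?_⟩
  · simp [hc.above i hi, he.above i hi]
  · simp [hc.off s hs i, hc.off s hs k]
  · rw [Finset.mem_sdiff]
    by_cases hsT : s ∈ T
    · simp [hsT, he.one s hsT]
    · simp [hsT, he.off s hsT, hc.mem_iff]

/-- The inner loop treats exactly the primes for which there is an entry in the row. -/
theorem reduceRow_spec {k j : Fin m} {S : Finset (Fin r)} (es : List (Entry m Q))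
    (hes : ∀ e ∈ es, (∃ T, IsEntry K h k e T) ∧ e.column < j ∧
      (K.simplex e.column).card = (K.simplex j).card)
    {U : Finset (Fin r)} {c : Fin m → ZMod Q} (hc : IsRowState K h k j S U c) :
    ∃ U', (reduceRow k es (primeProd q U) c).val.1 = primeProd q U' ∧
      IsRowState K h k j S U' (reduceRow k es (primeProd q U) c).val.2 ∧
      ∀ s, s ∈ U' ↔ s ∈ U ∧ ∀ e ∈ es, ¬ q s ∣ e.QT := by
  induction es generalizing U c with
  | nil => exact ⟨U, rfl, hc, by simp⟩
  | cons e es ih =>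
    obtain ⟨⟨T, he⟩, hlt, hcard⟩ := hes e (List.mem_cons_self ..)
    have ih := @ih fun e' he' => hes e' (List.mem_cons_of_mem _ he')
    have hgcd : Nat.gcd e.QT (primeProd q U) = primeProd q (U ∩ T) := by
      rw [he.QT_eq, h.gcd_primeProd_primeProd]
    rw [reduceRow]
    simp only [Counted.val_bind, hgcd, h.one_lt_primeProd_iff]
    have hdvd : ∀ s, q s ∣ e.QT ↔ s ∈ T := fun s => by rw [he.QT_eq, h.dvd_primeProd_iff]
    split_ifs with hne
    · simp only [Counted.val_bind, h.primeProd_div Finset.inter_subset_left,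
        Finset.sdiff_inter_self_left]
      obtain ⟨U', h₁, h₂, h₃⟩ := ih (hc.subMul he hlt hcard)
      refine ⟨U', h₁, h₂, fun s => ?_⟩
      simp only [h₃, Finset.mem_sdiff, List.forall_mem_cons, hdvd, and_assoc]
    · obtain ⟨U', h₁, h₂, h₃⟩ := ih hc
      refine ⟨U', h₁, h₂, fun s => ?_⟩
      simp only [h₃, List.forall_mem_cons, hdvd]
      refine ⟨fun hs => ⟨hs.1, fun hsT => hne ⟨s, Finset.mem_inter.2 ⟨hs.1, hsT⟩⟩, hs.2⟩,
        fun hs => ⟨hs.1, hs.2.2⟩⟩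

theorem cost_subMul (c : Fin m → ZMod Q) (a : ZMod Q) (c' : Fin m → ZMod Q) :
    (subMul c a c').cost = 3 * nnz c' := by
  simp only [subMul, Counted.cost_bind, cost_tick, OpCount.total, Counted.cost_pure]
  ring

theorem cost_scale (a : ZMod Q) (c : Fin m → ZMod Q) : (scale a c).cost = 2 * nnz c := by
  simp only [scale, Counted.cost_bind, cost_tick, OpCount.total, Counted.cost_pure]
  ring

theorem nnz_smul_le (a : ZMod Q) (c : Fin m → ZMod Q) : nnz (a • c) ≤ nnz c :=
  Finset.card_le_card fun i hi => by
    rw [Finset.mem_filter] at hi ⊢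
    exact ⟨hi.1, fun h0 => hi.2 (by simp [h0])⟩

theorem cost_reduceRow_le {D : ℕ} (hD : ∀ j, (K.simplex j).card ≤ D) {k : Fin m}
    (es : List (Entry m Q)) (hes : ∀ e ∈ es, ∃ T, IsEntry K h k e T) (QT : ℕ)
    (c : Fin m → ZMod Q) :
    (reduceRow k es QT c).cost ≤ 7 * D * (es.map fun e => (e.column : ℕ) - k).sum := by
  induction es generalizing QT c with
  | nil => simp [reduceRow]
  | cons e es ih =>
    have ih := ih fun e' he' => hes e' (List.mem_cons_of_mem _ he')
    obtain ⟨T, he⟩ := hes e (List.mem_cons_self ..)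
    have hlt : (k : ℕ) < e.column := he.lt
    have hnnz := he.red.nnz_le hD
    rw [Nat.add_sub_add_right] at hnnz
    have hpos : 1 ≤ D * ((e.column : ℕ) - k) :=
      Nat.mul_pos ((K.nonempty k).card_pos.trans_le (hD k)) (by omega)
    have hexp : 7 * D * ((e :: es).map fun e => (e.column : ℕ) - k).sum =
        7 * (D * ((e.column : ℕ) - k)) +
          7 * D * (es.map fun e => (e.column : ℕ) - k).sum := by
      rw [List.map_cons, List.sum_cons]; ring
    rw [reduceRow, hexp]
    simp only [Counted.cost_bind, cost_tick, OpCount.total]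
    split_ifs
    · simp only [Counted.cost_bind, cost_tick, OpCount.total, cost_subMul]
      have := ih (QT / e.QT.gcd QT) (Counted.val (MultiField.subMul c (c k) e.vec))
      omega
    · have := ih QT c
      omega

/-- A new entry is recorded for the primes in `U`, and the column stays to be reduced for the
others. -/
theorem record_spec {k j : Fin m} {S U : Finset (Fin r)} {c : Fin m → ZMod Q}
    (hc : IsRowState K h k j S U c) (hU : U.Nonempty) (st : State m Q) :
    ∃ e : Entry m Q, e.column = j ∧ IsEntry K h k e U ∧
      (record (List.ofFn q) j k (primeProd q U) c st).val.2 =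
        { table := Function.update st.table k (st.table k ++ [e])
          open_ := Function.update st.open_ k (st.open_ k / primeProd q U)
          output := st.output ++ [(k, (j : WithTop (Fin m)), primeProd q U)] } ∧
      IsColumnState K h k j (S \ U)
        (record (List.ofFn q) j k (primeProd q U) c st).val.1 := by
  have hx : ∀ s ∈ U, h.proj s (c k) ≠ 0 := fun s hs => (hc.mem_iff s).1 hs
  have hck : ∀ s ∉ U, h.proj s (c k) = 0 := fun s hs =>
    by_contra fun hne => hs ((hc.mem_iff s).2 hne)
  set a := (partialInverse Q (List.ofFn q) (c k) (primeProd q U)).val with ha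
  have ha₁ : ∀ s ∈ U, h.proj s (c k) * h.proj s a = 1 := fun s hs => by
    rw [ha, h.proj_partialInverse hx, if_pos hs]
  have ha₀ : ∀ s ∉ U, h.proj s a = 0 := fun s hs => h.proj_partialInverse_of_notMem hx hs
  refine ⟨⟨j, primeProd q U, a • c⟩, rfl, ?_, rfl, ?_⟩
  · refine ⟨rfl, hU, fun s hs i => ?_, fun s hs => ?_, fun i hi => ?_,
      hc.red.smul hc.subset (fun s hs h0 => ?_) h.prime⟩
    · simp [ha₀ s hs]
    · simp [mul_comm, ha₁ s hs]
    · simp [hc.above i hi]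
    · have : Fact (q s).Prime := ⟨h.prime s⟩
      have h1 := ha₁ s hs
      rw [h0, mul_zero] at h1
      exact zero_ne_one h1
  · change IsColumnState K h k j (S \ U) (c - c k • (a • c))
    have hprojU : ∀ s ∈ U, ∀ i, h.proj s ((c - c k • (a • c)) i) = 0 := fun s hs i => by
      simp [← mul_assoc, ha₁ s hs]
    have hproj : ∀ s ∉ U, ∀ i, h.proj s ((c - c k • (a • c)) i) = h.proj s (c i) :=
      fun s hs i => by simp [ha₀ s hs]
    refine ⟨fun i hi => ?_, ?_, fun s hs i => ?_⟩
    · rcases (show k ≤ i from hi).eq_or_lt with rfl | hlt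
      · refine h.eq_zero_of_proj fun s => ?_
        by_cases hs : s ∈ U
        · exact hprojU s hs k
        · rw [hproj s hs, hck s hs]
      · simp [hc.above i hlt]
    · have : c - c k • (a • c) = (1 - c k * a) • c := by
        rw [sub_smul, one_smul, mul_smul]
      rw [this]
      refine (hc.red.mono (Nat.le_succ _) Finset.Subset.rfl).smul Finset.sdiff_subset
        (fun s hs => ?_) h.prime
      have : Fact (q s).Prime := ⟨h.prime s⟩
      simp [ha₀ s (Finset.mem_sdiff.1 hs).2]
    · by_cases hsU : s ∈ U
      · exact hprojU s hsU i
      · rw [hproj s hsU]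
        exact hc.off s (fun hS => hs (Finset.mem_sdiff.2 ⟨hS, hsU⟩)) i

theorem cost_record_le {k j : Fin m} {S U : Finset (Fin r)} {c : Fin m → ZMod Q}
    (hc : IsRowState K h k j S U c) (st : State m Q) :
    (record (List.ofFn q) j k (primeProd q U) c st).cost ≤
      9 + 5 * nnz c + if primeProd q U = Q then 0 else 6 * r := by
  have hx : ∀ s ∈ U, h.proj s (c k) ≠ 0 := fun s hs => (hc.mem_iff s).1 hs
  have h₁ := h.cost_partialInverse_le hx
  rw [record]
  simp only [Counted.cost_bind, cost_tick, OpCount.total, Counted.cost_pure, cost_subMul,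
    cost_scale]
  have h₂ := nnz_smul_le (partialInverse Q (List.ofFn q) (c k) (primeProd q U)).val c
  have h₃ : (scale (partialInverse Q (List.ofFn q) (c k) (primeProd q U)).val c).val =
    (partialInverse Q (List.ofFn q) (c k) (primeProd q U)).val • c := rfl
  rw [h₃]
  omega

theorem IsColumnState.low_eq_none {b : ℕ} (hc : IsColumnState K h b j S c)
    (hlow : (low c (primeProd q S)).val = none) : c = 0 := by
  have hmax : (Finset.univ.filter (fun i => ¬ primeProd q S ∣ (c i).val)).max = ⊥ := hlow
  rw [Finset.max_eq_bot, Finset.filter_eq_empty_iff] at hmax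
  funext i
  refine h.eq_zero_of_proj fun s => ?_
  by_cases hs : s ∈ S
  · exact h.primeProd_dvd_val_iff.1 (not_not.1 (hmax (Finset.mem_univ i))) s hs
  · exact hc.off s hs i

theorem IsColumnState.low_eq_some {b : ℕ} (hc : IsColumnState K h b j S c) {k : Fin m}
    (hlow : (low c (primeProd q S)).val = some k) [∀ s, DecidableEq (ZMod (q s))] :
    (k : ℕ) < b ∧
    IsRowState K h k j S (S.filter (fun s => h.proj s (c k) ≠ 0)) c ∧
    (S.filter (fun s => h.proj s (c k) ≠ 0)).Nonempty := by
  have hmax : (Finset.univ.filter (fun i => ¬ primeProd q S ∣ (c i).val)).max =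
    ((k : Fin m) : WithBot (Fin m)) := hlow
  have hk := (Finset.mem_filter.1 (Finset.mem_of_max hmax)).2
  have hkb : (k : ℕ) < b := by
    by_contra hle
    rw [hc.above k (not_lt.1 hle)] at hk
    exact hk (by simp)
  rw [h.primeProd_dvd_val_iff] at hk
  push Not at hk
  refine ⟨hkb, ⟨fun i hi => ?_, hc.red.mono hkb Finset.Subset.rfl, hc.off,
    Finset.filter_subset _ _, fun s => ?_⟩, ?_⟩
  · refine h.eq_zero_of_proj fun s => ?_
    by_cases hs : s ∈ S
    · by_contra hne
      have hmem : i ∈ Finset.univ.filter (fun i => ¬ primeProd q S ∣ (c i).val) := by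
        rw [Finset.mem_filter, h.primeProd_dvd_val_iff]
        exact ⟨Finset.mem_univ i, fun hall => hne (hall s hs)⟩
      exact absurd (Finset.le_max_of_eq hmem hmax) (not_le.2 hi)
    · exact hc.off s hs i
  · rw [Finset.mem_filter, and_iff_right_iff_imp]
    exact fun hne => by_contra fun hs => hne (hc.off s hs k)
  · obtain ⟨s, hs, hne⟩ := hk
    exact ⟨s, Finset.mem_filter.2 ⟨hs, hne⟩⟩

/-- After the inner loop nothing is left to be recorded: the row has been reduced to zero. -/
theorem IsRowState.toColumnState {k : Fin m} (hc : IsRowState K h k j S ∅ c) :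
    IsColumnState K h k j S c := by
  refine ⟨fun i hi => ?_, hc.red.mono (Nat.le_succ _) Finset.Subset.rfl, hc.off⟩
  rcases (show k ≤ i from hi).eq_or_lt with rfl | hlt
  · exact h.eq_zero_of_proj fun s => by_contra fun hne => by
      simpa using (hc.mem_iff s).2 hne
  · exact hc.above i hlt

theorem cost_low (c : Fin m → ZMod Q) (QS : ℕ) : (low c QS).cost = 2 * nnz c + 1 := by
  simp only [low, Counted.cost_bind, cost_tick, OpCount.total, Counted.cost_pure]
  ring

end Reduction

/-! ### The invariant of the algorithm -/

section Invariant

variable {m r : ℕ} {q : Fin r → ℕ} {Q : ℕ} (K : FilteredComplex m) (h : IsPrimeFamily q Q)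

/-- The simplex `σ_a` is treated before `σ_b`: its dimension is larger, or they have the same
dimension and it comes first in the filtration. -/
def FilteredComplex.TreatedBefore (a b : Fin m) : Prop :=
  (K.simplex b).card < (K.simplex a).card ∨ (K.simplex a).card = (K.simplex b).card ∧ a < b

variable {K} in
theorem FilteredComplex.TreatedBefore.ne {a b : Fin m} (hab : K.TreatedBefore a b) : a ≠ b := by
  rintro rfl
  rcases hab with hlt | hlt
  · exact lt_irrefl _ hlt
  · exact lt_irrefl _ hlt.2

variable {K} in
theorem FilteredComplex.TreatedBefore.trans {a b c : Fin m} (hab : K.TreatedBefore a b)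
    (hbc : K.TreatedBefore b c) : K.TreatedBefore a c := by
  unfold TreatedBefore at *
  rcases hab with h₁ | ⟨h₁, h₁'⟩ <;> rcases hbc with h₂ | ⟨h₂, h₂'⟩
  · exact Or.inl (by omega)
  · exact Or.inl (by omega)
  · exact Or.inl (by omega)
  · exact Or.inr ⟨by omega, h₁'.trans h₂'⟩

/-- Modulo `q s`, the index `j` is paired as a birth index by an entry of the table. -/
def State.Born (q : Fin r → ℕ) (st : State m Q) (s : Fin r) (j : Fin m) : Prop :=
  ∃ e ∈ st.table j, q s ∣ e.QT

/-- Modulo `q s`, the index `j` is paired as a death index by an entry of the table. -/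
def State.Dead (q : Fin r → ℕ) (st : State m Q) (s : Fin r) (j : Fin m) : Prop :=
  ∃ k, ∃ e ∈ st.table k, e.column = j ∧ q s ∣ e.QT

/-- Whenever column `j` reduces to zero without being cleared, this has been reported. -/
def State.Done (q : Fin r → ℕ) (st : State m Q) (j : Fin m) : Prop :=
  ∀ s, ¬ st.Born q s j → ¬ st.Dead q s j → ∃ n, (j, (⊤ : WithTop (Fin m)), n) ∈ st.output

/-- The length of the finite interval that the triple `t` stands for, if it is born in `[lo, b)`
and dies before `j`, and `0` otherwise. -/
def scanWeight (j : Fin m) (lo b : ℕ) (t : Fin m × WithTop (Fin m) × ℕ) : ℕ :=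
  if lo ≤ (t.1 : ℕ) ∧ (t.1 : ℕ) < b then
    t.2.1.recTopCoe 0 (fun j' => if j' < j then (j' : ℕ) - t.1 else 0) else 0

/-- The sum of the weights `scanWeight j lo b` over a list of triples: up to a factor, the work of
the inner loop with all the entries in the rows `[lo, b)` whose columns come before `j`. -/
def scanSum (j : Fin m) (lo b : ℕ) (l : List (Fin m × WithTop (Fin m) × ℕ)) : ℕ :=
  (l.map (scanWeight j lo b)).sum

theorem scanSum_append (j : Fin m) (lo b : ℕ) (l l' : List (Fin m × WithTop (Fin m) × ℕ)) :
    scanSum j lo b (l ++ l') = scanSum j lo b l + scanSum j lo b l' := by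
  simp [scanSum]

theorem scanSum_succ_add_le (j : Fin m) {lo k b : ℕ} (hlo : lo ≤ k) (hk : k < b)
    (l : List (Fin m × WithTop (Fin m) × ℕ)) :
    scanSum j k (k + 1) l + scanSum j lo k l ≤ scanSum j lo b l := by
  rw [scanSum, scanSum, ← List.sum_map_add]
  refine List.sum_le_sum fun t _ => ?_
  unfold scanWeight
  split_ifs <;> omega

/-- The part of the invariant that does not refer to the column being treated. -/
structure StateInv (st : State m Q) : Prop where
  entry : ∀ k, ∀ e ∈ st.table k, ∃ T, IsEntry K h k e T
  coprime : ∀ k, (st.table k).Pairwise fun e e' => e.QT.Coprime e'.QT ∧ e.column ≠ e'.column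
  open_eq : ∀ k, ∃ S, st.open_ k = primeProd q S ∧ ∀ s, s ∈ S ↔ ¬ st.Born q s k
  mem_coe : ∀ k (j : Fin m) n, (k, (j : WithTop (Fin m)), n) ∈ st.output ↔
    ∃ e ∈ st.table k, e.column = j ∧ e.QT = n
  nodup : st.output.Nodup
  mem_top : ∀ j n, (j, (⊤ : WithTop (Fin m)), n) ∈ st.output → ∃ S : Finset (Fin r),
    S.Nonempty ∧ n = primeProd q S ∧ (∀ s, s ∈ S ↔ ¬ st.Born q s j ∧ ¬ st.Dead q s j) ∧
      ∀ s ∈ S, ∃ v : Fin m → ZMod (q s), HasLow v j ∧ K.boundary (ZMod (q s)) v = 0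
  scan : ∀ j k, ((st.table k).map fun e => if e.column < j then (e.column : ℕ) - k else 0).sum ≤
    scanSum j k (k + 1) st.output

/-- The part of the invariant about the column `j` that is being treated: it is still to be
reduced modulo the primes in `S`, in the rows below `b`. -/
structure ColumnInv (q : Fin r → ℕ) (K : FilteredComplex m) (b : ℕ) (j : Fin m) (S : Finset (Fin r)) (st : State m Q) : Prop where
  mem_iff : ∀ s, s ∈ S ↔ ¬ st.Born q s j ∧ ¬ st.Dead q s j
  column : ∀ k, ∀ e ∈ st.table k, (e.column = j ∧ b ≤ (k : ℕ)) ∨ K.TreatedBefore e.column j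
  top : ∀ j' n, (j', (⊤ : WithTop (Fin m)), n) ∈ st.output → K.TreatedBefore j' j

/-- The effect of the treatment of column `j` on the state, which outputs the triples `new`. -/
structure Treated (j : Fin m) (st st' : State m Q)
    (new : List (Fin m × WithTop (Fin m) × ℕ)) : Prop where
  inv : StateInv K h st'
  table : ∀ k, ∀ e ∈ st.table k, e ∈ st'.table k
  output : st'.output = st.output ++ new
  done : st'.Done q j
  column : ∀ k, ∀ e ∈ st'.table k, e.column = j ∨ K.TreatedBefore e.column j
  top : ∀ j' n, (j', (⊤ : WithTop (Fin m)), n) ∈ st'.output → j' = j ∨ K.TreatedBefore j' j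

variable {K h}

theorem Treated.done_mono {j j' : Fin m} {st st' : State m Q}
    {new : List (Fin m × WithTop (Fin m) × ℕ)} (ht : Treated K h j st st' new)
    (hd : st.Done q j') : st'.Done q j' := by
  intro s hb hdead
  obtain ⟨n, hn⟩ := hd s (fun ⟨e, he, hq⟩ => hb ⟨e, ht.table _ e he, hq⟩)
    (fun ⟨k, e, he, hq⟩ => hdead ⟨k, e, ht.table _ e he, hq⟩)
  exact ⟨n, ht.output ▸ List.mem_append_left _ hn⟩

/-- The state after an entry has been recorded at row `k`. -/
def State.addEntry (st : State m Q) (k j : Fin m) (e : Entry m Q) (n : ℕ) : State m Q where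
  table := Function.update st.table k (st.table k ++ [e])
  open_ := Function.update st.open_ k (st.open_ k / n)
  output := st.output ++ [(k, (j : WithTop (Fin m)), n)]

theorem State.mem_table_addEntry {st : State m Q} {k j : Fin m} {e : Entry m Q} {n : ℕ}
    {l : Fin m} {e' : Entry m Q} :
    e' ∈ (st.addEntry k j e n).table l ↔ e' ∈ st.table l ∨ l = k ∧ e' = e := by
  by_cases hl : l = k
  · subst hl; simp [State.addEntry]
  · simp [State.addEntry, hl]

/-- Recording an entry for the primes in `U` preserves the invariant, provided that these primes
were left over in row `k`. -/
theorem inv_addEntry {b : ℕ} {j k : Fin m} {S U : Finset (Fin r)} {st : State m Q}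
    {e : Entry m Q} (hst : StateInv K h st) (hcol : ColumnInv q K b j S st) (hkb : (k : ℕ) < b)
    (he : IsEntry K h k e U) (hej : e.column = j)
    (hnew : ∀ s ∈ U, ¬ st.Born q s k) :
    StateInv K h (st.addEntry k j e (primeProd q U)) ∧
      ColumnInv q K k j (S \ U) (st.addEntry k j e (primeProd q U)) := by
  have hcard : (K.simplex k).card + 1 = (K.simplex j).card := hej ▸ he.card_add_one
  have hkj : k ≠ j := by rintro rfl; omega
  have hcolk : ∀ e' ∈ st.table k, e'.column ≠ j := fun e' he' hj => by
    rcases hcol.column k e' he' with h₁ | h₁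
    · omega
    · exact h₁.ne hj
  have hdvd : ∀ s, q s ∣ e.QT ↔ s ∈ U := fun s => by rw [he.QT_eq, h.dvd_primeProd_iff]
  have hborn : ∀ s l, (st.addEntry k j e (primeProd q U)).Born q s l ↔
      st.Born q s l ∨ l = k ∧ s ∈ U := by
    intro s l
    simp only [State.Born, State.mem_table_addEntry]
    constructor
    · rintro ⟨e', he' | ⟨rfl, rfl⟩, hq⟩
      · exact Or.inl ⟨e', he', hq⟩
      · exact Or.inr ⟨rfl, (hdvd s).1 hq⟩
    · rintro (⟨e', he', hq⟩ | ⟨rfl, hs⟩)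
      · exact ⟨e', Or.inl he', hq⟩
      · exact ⟨e, Or.inr ⟨rfl, rfl⟩, (hdvd s).2 hs⟩
  have hdead : ∀ s l, (st.addEntry k j e (primeProd q U)).Dead q s l ↔
      st.Dead q s l ∨ l = j ∧ s ∈ U := by
    intro s l
    simp only [State.Dead, State.mem_table_addEntry]
    constructor
    · rintro ⟨k', e', he' | ⟨rfl, rfl⟩, hl, hq⟩
      · exact Or.inl ⟨k', e', he', hl, hq⟩
      · exact Or.inr ⟨hl.symm.trans hej, (hdvd s).1 hq⟩
    · rintro (⟨k', e', he', hl, hq⟩ | ⟨rfl, hs⟩)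
      · exact ⟨k', e', Or.inl he', hl, hq⟩
      · exact ⟨k, e, Or.inr ⟨rfl, rfl⟩, hej, (hdvd s).2 hs⟩
  have htop : ∀ j' n, (j', (⊤ : WithTop (Fin m)), n) ∈
      (st.addEntry k j e (primeProd q U)).output ↔ (j', (⊤ : WithTop (Fin m)), n) ∈ st.output := by
    intro j' n
    simp [State.addEntry]
  refine ⟨⟨fun l e' he' => ?_, fun l => ?_, fun l => ?_, fun l j' n => ?_, ?_, fun j' n hn => ?_,
    fun j' l => ?_⟩, fun s => ?_, fun l e' he' => ?_, fun j' n hn => ?_⟩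
  · rcases State.mem_table_addEntry.1 he' with he' | ⟨rfl, rfl⟩
    · exact hst.entry l e' he'
    · exact ⟨U, he⟩
  · by_cases hl : l = k
    · subst hl
      simp only [State.addEntry, Function.update_self]
      rw [List.pairwise_append]
      refine ⟨hst.coprime l, List.pairwise_singleton _ _, fun e' he' e'' he'' => ?_⟩
      obtain rfl := List.mem_singleton.1 he''
      refine ⟨?_, hej ▸ hcolk e' he'⟩
      obtain ⟨T, hT⟩ := hst.entry l e' he'
      rw [hT.QT_eq, he.QT_eq, h.coprime_primeProd_iff, Finset.disjoint_left]
      exact fun s hs hsU => hnew s hsU ⟨e', he', by rwa [hT.QT_eq, h.dvd_primeProd_iff]⟩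
    · simpa [State.addEntry, hl] using hst.coprime l
  · obtain ⟨S', hS', hmem⟩ := hst.open_eq l
    by_cases hl : l = k
    · subst hl
      refine ⟨S' \ U, ?_, fun s => ?_⟩
      · simp only [State.addEntry, Function.update_self, hS']
        exact h.primeProd_div fun s hs => (hmem s).2 (hnew s hs)
      · rw [Finset.mem_sdiff, hmem, hborn]
        tauto
    · refine ⟨S', by simp [State.addEntry, hl, hS'], fun s => ?_⟩
      rw [hmem, hborn]
      tauto
  · rw [State.addEntry, List.mem_append, hst.mem_coe, List.mem_singleton]
    change _ ↔ ∃ e' ∈ (st.addEntry k j e (primeProd q U)).table l, _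
    simp only [State.mem_table_addEntry, Prod.mk.injEq, WithTop.coe_inj]
    constructor
    · rintro (⟨e', he', hj', hn⟩ | ⟨rfl, rfl, rfl⟩)
      · exact ⟨e', Or.inl he', hj', hn⟩
      · exact ⟨e, Or.inr ⟨rfl, rfl⟩, hej, he.QT_eq⟩
    · rintro ⟨e', he' | ⟨rfl, rfl⟩, hj', hn⟩
      · exact Or.inl ⟨e', he', hj', hn⟩
      · exact Or.inr ⟨rfl, hj'.symm.trans hej, hn.symm.trans he.QT_eq⟩
  · rw [State.addEntry]
    refine List.nodup_append.2 ⟨hst.nodup, List.nodup_singleton _, fun t ht t' ht' => ?_⟩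
    obtain rfl := List.mem_singleton.1 ht'
    rintro rfl
    obtain ⟨e', he', hj', _⟩ := (hst.mem_coe _ _ _).1 ht
    exact hcolk e' he' hj'
  · have hn := (htop j' n).1 hn
    obtain ⟨S', hne, hS', hmem, hcyc⟩ := hst.mem_top j' n hn
    have hj' := hcol.top j' n hn
    have hk' : j' ≠ k := by
      rintro rfl
      rcases hj' with h₁ | h₁ <;> omega
    refine ⟨S', hne, hS', fun s => ?_, hcyc⟩
    rw [hmem, hborn, hdead]
    have := hj'.ne
    tauto
  · have hold := hst.scan j' l
    rw [State.addEntry]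
    dsimp only
    rw [scanSum_append]
    by_cases hl : l = k
    · subst hl
      rw [Function.update_self, List.map_append, List.sum_append]
      refine Nat.add_le_add hold ?_
      simp [scanSum, scanWeight, hej]
    · rw [Function.update_of_ne hl]
      exact hold.trans (Nat.le_add_right _ _)
  · rw [Finset.mem_sdiff, hcol.mem_iff, hborn, hdead]
    tauto
  · rcases State.mem_table_addEntry.1 he' with he' | ⟨rfl, rfl⟩
    · rcases hcol.column l e' he' with h₁ | h₁
      · exact Or.inl ⟨h₁.1, by omega⟩
      · exact Or.inr h₁
    · exact Or.inl ⟨hej, le_rfl⟩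
  · exact hcol.top j' n ((htop j' n).1 hn)

/-- The end of the reduction of column `j`, if it is zero modulo the primes in `S`. -/
theorem treated_top {b : ℕ} {j : Fin m} {S : Finset (Fin r)} {st : State m Q}
    (hst : StateInv K h st) (hcol : ColumnInv q K b j S st) (hS : S.Nonempty)
    (hred : IsReduction K h b j S 0) :
    Treated K h j st { st with output := st.output ++ [(j, ⊤, primeProd q S)] }
      [(j, ⊤, primeProd q S)] := by
  have hnot : ∀ n, (j, (⊤ : WithTop (Fin m)), n) ∉ st.output := fun n hn =>
    (hcol.top j n hn).ne rfl
  have hmemtop : ∀ j' n, (j', (⊤ : WithTop (Fin m)), n) ∈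
      st.output ++ [(j, (⊤ : WithTop (Fin m)), primeProd q S)] →
      (j', (⊤ : WithTop (Fin m)), n) ∈ st.output ∨ j' = j ∧ n = primeProd q S := by
    intro j' n hn
    simpa using hn
  refine ⟨⟨hst.entry, hst.coprime, hst.open_eq, fun l j' n => ?_, ?_, fun j' n hn => ?_,
    fun j' l => ?_⟩, fun _ _ => id, rfl, fun s _ _ => ⟨primeProd q S, by simp⟩,
    fun k e he => ?_, fun j' n hn => ?_⟩
  · simpa using hst.mem_coe l j' n
  · refine List.nodup_append.2 ⟨hst.nodup, List.nodup_singleton _, fun t ht t' ht' => ?_⟩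
    obtain rfl := List.mem_singleton.1 ht'
    rintro rfl
    exact hnot _ ht
  · rcases hmemtop j' n hn with hn | ⟨rfl, rfl⟩
    · exact hst.mem_top j' n hn
    · refine ⟨S, hS, rfl, hcol.mem_iff, fun s hs => ?_⟩
      obtain ⟨v, hv, hsupp, hu⟩ := hred
      refine ⟨fun l => h.proj s (v l), ⟨hu s hs, fun l hl => ?_⟩, ?_⟩
      · have : v l = 0 := by_contra fun hne => absurd (hsupp l hne).2.1 (not_le.2 hl)
        simp [this]
      · funext i
        rw [← K.map_boundary (h.proj s) v i, ← hv]
        simp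
  · refine (hst.scan j' l).trans ?_
    rw [scanSum_append]
    exact Nat.le_add_right _ _
  · exact (hcol.column k e he).imp (fun h₁ => h₁.1) id
  · rcases hmemtop j' n hn with hn | ⟨rfl, _⟩
    · exact Or.inr (hcol.top j' n hn)
    · exact Or.inl rfl

theorem treated_of_empty {b : ℕ} {j : Fin m} {st : State m Q}
    (hst : StateInv K h st) (hcol : ColumnInv q K b j ∅ st) : Treated K h j st st [] := by
  refine ⟨hst, fun _ _ => id, (List.append_nil _).symm, fun s hb hd => ?_,
    fun k e he => (hcol.column k e he).imp (fun h₁ => h₁.1) id,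
    fun j' n hn => Or.inr (hcol.top j' n hn)⟩
  simpa using (hcol.mem_iff s).2 ⟨hb, hd⟩

end Invariant

/-! ### The treatment of a column -/

section Algorithm

variable {m r : ℕ} {q : Fin r → ℕ} {Q : ℕ} {K : FilteredComplex m} {h : IsPrimeFamily q Q}

theorem val_reduceColumn_of_none (qs : List ℕ) (j : Fin m) (fuel : ℕ) {QS : ℕ}
    {c : Fin m → ZMod Q} (st : State m Q) (hlow : (low c QS).val = none) :
    (reduceColumn qs j (fuel + 1) QS c st).val =
      if QS = 1 then st else { st with output := st.output ++ [(j, ⊤, QS)] } := by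
  rw [reduceColumn]
  simp only [Counted.val_bind, hlow]
  split_ifs <;> rfl

theorem cost_reduceColumn_of_none (qs : List ℕ) (j : Fin m) (fuel : ℕ) {QS : ℕ}
    {c : Fin m → ZMod Q} (st : State m Q) (hlow : (low c QS).val = none) :
    (reduceColumn qs j (fuel + 1) QS c st).cost = 2 * nnz c + 3 := by
  rw [reduceColumn]
  simp only [Counted.cost_bind, hlow, cost_low, cost_tick, OpCount.total]
  split_ifs <;> simp only [Counted.cost_pure]

theorem val_reduceColumn_of_some (qs : List ℕ) (j : Fin m) (fuel : ℕ) {QS : ℕ}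
    {c : Fin m → ZMod Q} (st : State m Q) {k : Fin m} (hlow : (low c QS).val = some k)
    {p : ℕ × (Fin m → ZMod Q)}
    (hp : (reduceRow k (st.table k) (QS / Nat.gcd (c k).val QS) c).val = p) :
    (reduceColumn qs j (fuel + 1) QS c st).val =
      if p.1 = 1 then (reduceColumn qs j fuel QS p.2 st).val
      else (reduceColumn qs j fuel (QS / p.1) (record qs j k p.1 p.2 st).val.1
        (record qs j k p.1 p.2 st).val.2).val := by
  rw [reduceColumn]
  simp only [Counted.val_bind, hlow, hp]
  split_ifs <;> rfl

theorem cost_reduceColumn_of_some (qs : List ℕ) (j : Fin m) (fuel : ℕ) {QS : ℕ}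
    {c : Fin m → ZMod Q} (st : State m Q) {k : Fin m} (hlow : (low c QS).val = some k)
    {p : ℕ × (Fin m → ZMod Q)}
    (hp : (reduceRow k (st.table k) (QS / Nat.gcd (c k).val QS) c).val = p) :
    (reduceColumn qs j (fuel + 1) QS c st).cost =
      2 * nnz c + 5 + (reduceRow k (st.table k) (QS / Nat.gcd (c k).val QS) c).cost +
      if p.1 = 1 then (reduceColumn qs j fuel QS p.2 st).cost
      else (record qs j k p.1 p.2 st).cost + 1 +
        (reduceColumn qs j fuel (QS / p.1) (record qs j k p.1 p.2 st).val.1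
          (record qs j k p.1 p.2 st).val.2).cost := by
  rw [reduceColumn]
  simp only [Counted.cost_bind, hlow, hp, cost_low, cost_tick, OpCount.total]
  split_ifs
  · ring
  · simp only [Counted.cost_bind, cost_tick, OpCount.total]
    ring

/-- The number of triples in a list that die at `j`. -/
def countDying (j : Fin m) (l : List (Fin m × WithTop (Fin m) × ℕ)) : ℕ :=
  l.countP fun t => t.2.1 = (j : WithTop (Fin m))

/-- The number of triples in a list that die at `j` for some of the primes only. -/
def countPartialDying (Q : ℕ) (j : Fin m) (l : List (Fin m × WithTop (Fin m) × ℕ)) : ℕ :=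
  l.countP fun t => t.2.1 = (j : WithTop (Fin m)) ∧ t.2.2 ≠ Q

/-- The triples in `l` show that column `j` reduces to zero modulo some prime, and `lo = 0`, or that
`(lo, j)` is an interval modulo some prime. -/
def IsLastRow (j : Fin m) (lo : ℕ) (l : List (Fin m × WithTop (Fin m) × ℕ)) : Prop :=
  (lo = 0 ∧ ∃ n, (j, (⊤ : WithTop (Fin m)), n) ∈ l) ∨
    ∃ (k : Fin m) (n : ℕ), (k : ℕ) = lo ∧ (k, (j : WithTop (Fin m)), n) ∈ l

/-- The result and the cost of the outer loop.  The loop goes through rows in `[lo, b)`.  In each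
of them it searches a column with at most `D (j + 1 - lo)` coefficients and runs through the
entries found there; the work per new entry is proportional to the size of the column, and to the
number of primes if the entry does not concern all of them. -/
theorem reduceColumn_spec {D : ℕ} (hD : ∀ j, (K.simplex j).card ≤ D) {j : Fin m} (fuel : ℕ)
    {b : ℕ} (hfuel : b < fuel) (hbj : b ≤ j) {S : Finset (Fin r)} {c : Fin m → ZMod Q}
    {st : State m Q} (hst : StateInv K h st) (hcol : ColumnInv q K b j S st)
    (hc : IsColumnState K h b j S c) :
    ∃ new, Treated K h j st
        (reduceColumn (List.ofFn q) j fuel (primeProd q S) c st).val new ∧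
      ∃ lo ≤ b, (S = ∅ → lo = b) ∧ (S.Nonempty → IsLastRow j lo new) ∧
        (reduceColumn (List.ofFn q) j fuel (primeProd q S) c st).cost ≤
          7 * D * scanSum j lo b
            (reduceColumn (List.ofFn q) j fuel (primeProd q S) c st).val.output +
          (b - lo + 1) * (2 * (D * (j + 1 - lo)) + 9) +
          countDying j new * (10 + 5 * (D * (j + 1 - lo))) +
          countPartialDying Q j new * (6 * r) := by
  classical
  induction fuel generalizing b S c st with
  | zero => exact absurd hfuel (Nat.not_lt_zero _)
  | succ fuel ih =>
    have hnnz := hc.red.nnz_le hD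
    rcases hlow : (low c (primeProd q S)).val with _ | k
    · have hc0 := hc.low_eq_none hlow
      rw [val_reduceColumn_of_none _ _ _ _ hlow, cost_reduceColumn_of_none _ _ _ _ hlow]
      rcases S.eq_empty_or_nonempty with rfl | hS
      · rw [if_pos (h.primeProd_eq_one_iff.2 rfl)]
        refine ⟨[], treated_of_empty hst hcol, b, le_rfl, fun _ => rfl,
          fun hne => absurd rfl hne.ne_empty, ?_⟩
        rw [Nat.sub_self, zero_add, one_mul]
        omega
      · rw [if_neg fun he => hS.ne_empty (h.primeProd_eq_one_iff.1 he)]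
        subst hc0
        refine ⟨_, treated_top hst hcol hS hc.red, 0, Nat.zero_le _,
          fun he => absurd he hS.ne_empty, fun _ => Or.inl ⟨rfl, primeProd q S, by simp⟩, ?_⟩
        have h0 : nnz (0 : Fin m → ZMod Q) = 0 := by simp [nnz]
        rw [h0]
        have : 1 * 9 ≤ (b - 0 + 1) * (2 * (D * (j + 1 - 0)) + 9) :=
          Nat.mul_le_mul (by omega) (by omega)
        omega
    · obtain ⟨hkb, hrow, hne⟩ := hc.low_eq_some hlow
      set U := S.filter (fun s => h.proj s (c k) ≠ 0) with hU
      have hdiv : primeProd q S / Nat.gcd (c k).val (primeProd q S) = primeProd q U := by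
        rw [h.gcd_val_primeProd, h.primeProd_div (Finset.filter_subset _ _), hU,
          Finset.filter_not]
      have hcard : (K.simplex k).card + 1 = (K.simplex j).card := by
        refine hrow.red.card_add_one fun h0 => ?_
        obtain ⟨s, hs⟩ := hne
        exact (hrow.mem_iff s).1 hs (by rw [h0, map_zero])
      have hkj : (k : ℕ) < j := lt_of_lt_of_le hkb hbj
      have hentries : ∀ e ∈ st.table k, (∃ T, IsEntry K h k e T) ∧ e.column < j ∧
          (K.simplex e.column).card = (K.simplex j).card := by
        intro e he
        obtain ⟨T, hT⟩ := hst.entry k e he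
        have hcard' := hT.card_add_one
        refine ⟨⟨T, hT⟩, ?_, by omega⟩
        rcases hcol.column k e he with h₁ | h₁ | h₁
        · omega
        · omega
        · exact h₁.2
      have hscan : (reduceRow k (st.table k) (primeProd q U) c).cost ≤
          7 * D * scanSum j k (k + 1) st.output := by
        refine (cost_reduceRow_le hD _ (hst.entry k) _ _).trans (Nat.mul_le_mul_left _ ?_)
        refine le_trans (le_of_eq ?_) (hst.scan j k)
        congr 1
        exact List.map_congr_left fun e he => (if_pos (hentries e he).2.1).symm
      obtain ⟨U', hU', hrow', hleft⟩ := reduceRow_spec (st.table k) hentries hrow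
      obtain ⟨c', hc'⟩ : ∃ c', c' = (reduceRow k (st.table k) (primeProd q U) c).val.2 := ⟨_, rfl⟩
      rw [← hc'] at hrow'
      have hp : (reduceRow k (st.table k) (primeProd q S / Nat.gcd (c k).val (primeProd q S))
          c).val = (primeProd q U', c') := by
        rw [hdiv, hc']
        exact Prod.ext hU' rfl
      rw [val_reduceColumn_of_some _ _ _ _ hlow hp, cost_reduceColumn_of_some _ _ _ _ hlow hp,
        hdiv]
      dsimp only
      have hrounds : ∀ lo ≤ (k : ℕ), ∀ X,
          (k - lo + 1) * (2 * X + 9) + (2 * X + 9) ≤ (b - lo + 1) * (2 * X + 9) := by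
        intro lo hlo X
        rw [← Nat.succ_mul]
        exact Nat.mul_le_mul_right _ (by omega)
      have hscanle : ∀ lo ≤ (k : ℕ), ∀ out, 7 * D * scanSum j k (k + 1) out +
          7 * D * scanSum j lo k out ≤ 7 * D * scanSum j lo b out := by
        intro lo hlo out
        rw [← Nat.mul_add]
        exact Nat.mul_le_mul_left _ (scanSum_succ_add_le j hlo hkb out)
      have hscanmono : ∀ {st₁ st₂ new}, Treated K h j st₁ st₂ new →
          7 * D * scanSum j k (k + 1) st₁.output ≤ 7 * D * scanSum j k (k + 1) st₂.output := by
        intro st₁ st₂ new ht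
        rw [ht.output, scanSum_append]
        exact Nat.mul_le_mul_left _ (Nat.le_add_right _ _)
      have hX : ∀ lo ≤ (k : ℕ), D * (j + 1 - b) ≤ D * (j + 1 - lo) := fun lo hlo =>
        Nat.mul_le_mul_left _ (by omega)
      by_cases hU'0 : U' = ∅
      · subst hU'0
        rw [if_pos (h.primeProd_eq_one_iff.2 rfl)]
        have hS : S.Nonempty := hne.mono (Finset.filter_subset _ _)
        have hcol' : ColumnInv q K k j S st := ⟨hcol.mem_iff, fun l e he =>
          (hcol.column l e he).imp (fun h₁ => ⟨h₁.1, by omega⟩) id, hcol.top⟩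
        obtain ⟨new, ht, lo, hlo, _, hlast, hcost⟩ := ih (by omega) hkj.le hst hcol'
          hrow'.toColumnState
        refine ⟨new, ht, lo, by omega, fun he => absurd he hS.ne_empty, hlast, ?_⟩
        rw [if_pos (h.primeProd_eq_one_iff.2 rfl)]
        have e₁ := hrounds lo hlo (D * (j + 1 - lo))
        have e₂ := hscanle lo hlo
          (reduceColumn (List.ofFn q) j fuel (primeProd q S) c' st).val.output
        have e₃ := hscanmono ht
        have e₄ := hX lo hlo
        omega
      · have hU'ne : U'.Nonempty := Finset.nonempty_iff_ne_empty.2 hU'0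
        rw [if_neg fun he => hU'0 (h.primeProd_eq_one_iff.1 he)]
        obtain ⟨e, hej, he, hrec, hcs⟩ := record_spec hrow' hU'ne st
        have hreccost := cost_record_le hrow' st
        have hnnz' := hrow'.red.nnz_le hD
        obtain ⟨hst', hcol'⟩ := inv_addEntry hst hcol hkb he hej fun s hs ⟨e', he', hq⟩ =>
          ((hleft s).1 hs).2 e' he' hq
        rw [if_neg fun he => hU'0 (h.primeProd_eq_one_iff.1 he), hrec,
          h.primeProd_div hrow'.subset]
        obtain ⟨new, ht, lo, hlo, hlo', hlast, hcost⟩ := ih (by omega) hkj.le hst' hcol' hcs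
        have ht' : Treated K h j st (reduceColumn (List.ofFn q) j fuel (primeProd q (S \ U'))
            (record (List.ofFn q) j k (primeProd q U') c' st).val.1
            (st.addEntry k j e (primeProd q U'))).val
            ((k, (j : WithTop (Fin m)), primeProd q U') :: new) :=
          ⟨ht.inv, fun l e' he' => ht.table l e' (State.mem_table_addEntry.2 (Or.inl he')), by
            rw [ht.output, State.addEntry, List.append_assoc]; rfl, ht.done, ht.column, ht.top⟩
        refine ⟨_, ht', lo, by omega, fun hS => absurd (hS ▸ hrow'.subset)
          (fun hsub => hU'0 (Finset.subset_empty.1 hsub)), fun _ => ?_, ?_⟩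
        · rcases (S \ U').eq_empty_or_nonempty with hS' | hS'
          · exact Or.inr ⟨k, _, (hlo' hS').symm, List.mem_cons_self ..⟩
          · rcases hlast hS' with ⟨h0, n, hn⟩ | ⟨k', n, hk', hn⟩
            · exact Or.inl ⟨h0, n, List.mem_cons_of_mem _ hn⟩
            · exact Or.inr ⟨k', n, hk', List.mem_cons_of_mem _ hn⟩
        · have e₁ := hrounds lo hlo (D * (j + 1 - lo))
          have e₂ := hscanle lo hlo (reduceColumn (List.ofFn q) j fuel (primeProd q (S \ U'))
            (record (List.ofFn q) j k (primeProd q U') c' st).val.1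
            (st.addEntry k j e (primeProd q U'))).val.output
          have e₃ := hscanmono ht'
          have e₄ := hX lo hlo
          have e₅ : D * (j + 1 - (k + 1)) ≤ D * (j + 1 - lo) := Nat.mul_le_mul_left _ (by omega)
          have e₆ : countDying j ((k, (j : WithTop (Fin m)), primeProd q U') :: new) =
              countDying j new + 1 := by
            simp [countDying]
          have e₇ : countPartialDying Q j ((k, (j : WithTop (Fin m)), primeProd q U') :: new) *
              (6 * r) = countPartialDying Q j new * (6 * r) +
                if primeProd q U' = Q then 0 else 6 * r := by
            by_cases hQ : primeProd q U' = Q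
            · simp [countPartialDying, hQ]
            · simp [countPartialDying, hQ, Nat.succ_mul]
          rw [e₆, e₇, Nat.succ_mul (countDying j new)]
          change (reduceColumn (List.ofFn q) j fuel (primeProd q (S \ U'))
            (record (List.ofFn q) j k (primeProd q U') c' st).val.1
            (st.addEntry k j e (primeProd q U'))).cost ≤ _ at hcost
          change _ + (_ + (reduceColumn (List.ofFn q) j fuel (primeProd q (S \ U'))
            (record (List.ofFn q) j k (primeProd q U') c' st).val.1
            (st.addEntry k j e (primeProd q U'))).cost) ≤ 7 * D * scanSum j lo b
            (reduceColumn (List.ofFn q) j fuel (primeProd q (S \ U'))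
            (record (List.ofFn q) j k (primeProd q U') c' st).val.1
            (st.addEntry k j e (primeProd q U'))).val.output + _ + _ + _
          omega

/-- Column `j` is the birth index of a finite interval in the list `l`. -/
def IsBornIn (j : Fin m) (l : List (Fin m × WithTop (Fin m) × ℕ)) : Prop :=
  ∃ (j' : Fin m) (n : ℕ), (j, (j' : WithTop (Fin m)), n) ∈ l

open Classical in
/-- The bound on the cost of the treatment of column `j`, in terms of a list of triples: a constant
if the column is cleared for all primes, and otherwise the cost of the outer loop down to the row
`lo` together with the cost of clearing the column for some of the primes. -/
def ColumnCost (D r Q : ℕ) (l : List (Fin m × WithTop (Fin m) × ℕ)) (j : Fin m) (x : ℕ) : Prop :=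
  x ≤ 2 ∨ ∃ lo ≤ (j : ℕ), IsLastRow j lo l ∧
    x ≤ 7 * D * scanSum j lo j l + (j - lo + 1) * (2 * (D * (j + 1 - lo)) + 9) +
      countDying j l * (10 + 5 * (D * (j + 1 - lo))) + countPartialDying Q j l * (6 * r) +
      (3 + 3 * D + if IsBornIn j l then 6 * r else 0)

theorem ColumnCost.append {D x : ℕ} {l : List (Fin m × WithTop (Fin m) × ℕ)} {j : Fin m}
    (hx : ColumnCost D r Q l j x) (l' : List (Fin m × WithTop (Fin m) × ℕ)) :
    ColumnCost D r Q (l ++ l') j x := by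
  rcases hx with hx | ⟨lo, hlo, hlast, hx⟩
  · exact Or.inl hx
  · refine Or.inr ⟨lo, hlo, ?_, hx.trans ?_⟩
    · rcases hlast with ⟨h0, n, hn⟩ | ⟨k', n, hk', hn⟩
      · exact Or.inl ⟨h0, n, List.mem_append_left _ hn⟩
      · exact Or.inr ⟨k', n, hk', List.mem_append_left _ hn⟩
    · have e₁ : scanSum j lo j l ≤ scanSum j lo j (l ++ l') := by
        rw [scanSum_append]; exact Nat.le_add_right _ _
      have e₂ : countDying j l ≤ countDying j (l ++ l') := by
        rw [countDying, countDying, List.countP_append]; exact Nat.le_add_right _ _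
      have e₃ : countPartialDying Q j l ≤ countPartialDying Q j (l ++ l') := by
        rw [countPartialDying, countPartialDying, List.countP_append]; exact Nat.le_add_right _ _
      have e₄ : IsBornIn j l → IsBornIn j (l ++ l') := fun ⟨j', n, hn⟩ =>
        ⟨j', n, List.mem_append_left _ hn⟩
      gcongr
      split_ifs with h₁ h₂ h₂
      · exact le_rfl
      · exact absurd (e₄ h₁) h₂
      · exact Nat.zero_le _
      · exact le_rfl

/-- The initial form of column `j`, which is the boundary of `σ_j`. -/
theorem isColumnState_boundaryMatrix (K : FilteredComplex m) (h : IsPrimeFamily q Q) (j : Fin m) :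
    IsColumnState K h j j Finset.univ (fun i => K.boundaryMatrix (ZMod Q) i j) := by
  refine ⟨fun i hi => by_contra fun hne =>
      absurd (K.lt_of_boundaryMatrix_ne_zero _ hne) (not_lt.2 hi),
    ⟨Pi.single j 1, ?_, fun l hl => ?_, fun s _ => ?_⟩, fun s hs => absurd (Finset.mem_univ s) hs⟩
  · funext i
    simp [K.boundary_apply, Pi.single_apply]
  · have : l = j := by_contra fun hne => hl (by simp [hne])
    subst this
    exact ⟨le_rfl, le_rfl, rfl⟩
  · have : Fact (q s).Prime := ⟨h.prime s⟩
    simp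

theorem IsColumnState.smul {b : ℕ} {j : Fin m} {c : Fin m → ZMod Q}
    (hc : IsColumnState K h b j Finset.univ c) {a : ZMod Q} {S : Finset (Fin r)}
    (ha : ∀ s, h.proj s a = if s ∈ S then 1 else 0) : IsColumnState K h b j S (a • c) := by
  refine ⟨fun i hi => by simp [hc.above i hi],
    hc.red.smul (Finset.subset_univ S) (fun s hs => ?_) h.prime, fun s hs i => by simp [ha, hs]⟩
  have : Fact (q s).Prime := ⟨h.prime s⟩
  simp [ha, hs]

theorem handleColumn_spec {D : ℕ} (hD : ∀ j, (K.simplex j).card ≤ D) {j : Fin m}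
    {st : State m Q} (hst : StateInv K h st)
    (hbefore : ∀ k, ∀ e ∈ st.table k, K.TreatedBefore e.column j)
    (htop : ∀ j' n, (j', (⊤ : WithTop (Fin m)), n) ∈ st.output → K.TreatedBefore j' j) :
    ∃ new, Treated K h j st (handleColumn K (List.ofFn q) j st).val new ∧
      ColumnCost D r Q (handleColumn K (List.ofFn q) j st).val.output j
        (handleColumn K (List.ofFn q) j st).cost := by
  obtain ⟨S, hS, hmem⟩ := hst.open_eq j
  have hdead : ∀ s, ¬ st.Dead q s j := fun s ⟨k, e, he, hj, _⟩ => (hbefore k e he).ne hj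
  have hcol : ColumnInv q K j j S st :=
    ⟨fun s => by simp [hmem, hdead], fun k e he => Or.inr (hbefore k e he), htop⟩
  have hc := isColumnState_boundaryMatrix K h j
  set c : Fin m → ZMod Q := fun i => K.boundaryMatrix (ZMod Q) i j with hcdef
  have hnnz : nnz c ≤ D := by simpa using hc.red.nnz_le hD
  rw [handleColumn, ← hcdef]
  simp only [Counted.val_bind, Counted.cost_bind, cost_tick, OpCount.total, hS]
  by_cases hS0 : S = ∅
  · subst hS0
    rw [if_pos (h.primeProd_eq_one_iff.2 rfl)]
    exact ⟨[], treated_of_empty hst hcol, Or.inl (by simp)⟩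
  rw [if_neg fun he => hS0 (h.primeProd_eq_one_iff.1 he)]
  have hSne := Finset.nonempty_iff_ne_empty.2 hS0
  -- The cost `x` of the outer loop and a small overhead `y`.
  have hfinish : ∀ {st' : State m Q} {new : List (Fin m × WithTop (Fin m) × ℕ)} {lo x y : ℕ},
      Treated K h j st st' new → IsLastRow j lo new → lo ≤ (j : ℕ) →
      x ≤ 7 * D * scanSum j lo j st'.output +
          (j - lo + 1) * (2 * (D * (j + 1 - lo)) + 9) +
          countDying j new * (10 + 5 * (D * (j + 1 - lo))) +
          countPartialDying Q j new * (6 * r) →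
      (y ≤ 3 + 3 * D ∨ IsBornIn j st'.output ∧ y ≤ 3 + 3 * D + 6 * r) →
      ColumnCost D r Q st'.output j (x + y) := by
    intro st' new lo x y ht hlast hlo hx hy
    refine Or.inr ⟨lo, hlo, ?_, ?_⟩
    · rcases hlast with ⟨h0, n, hn⟩ | ⟨k', n, hk', hn⟩
      · exact Or.inl ⟨h0, n, ht.output ▸ List.mem_append_right _ hn⟩
      · exact Or.inr ⟨k', n, hk', ht.output ▸ List.mem_append_right _ hn⟩
    · have e₂ : countDying j new ≤ countDying j st'.output := by
        rw [ht.output, countDying, countDying, List.countP_append]; exact Nat.le_add_left _ _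
      have e₃ : countPartialDying Q j new ≤ countPartialDying Q j st'.output := by
        rw [ht.output, countPartialDying, countPartialDying, List.countP_append]
        exact Nat.le_add_left _ _
      refine Nat.add_le_add (hx.trans (by gcongr)) ?_
      rcases hy with hy | ⟨hb, hy⟩
      · omega
      · rw [if_pos hb]; omega
  by_cases hSu : S = Finset.univ
  · subst hSu
    simp only [Counted.val_bind, Counted.cost_bind, cost_tick, OpCount.total,
      if_pos (h.primeProd_eq_iff.2 rfl)]
    obtain ⟨new, ht, lo, hlo, _, hlast, hcost⟩ :=
      reduceColumn_spec hD (m + 1) (by omega) le_rfl hst hcol hc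
    refine ⟨new, ht, ?_⟩
    have := hfinish (y := 2 + nnz c) ht (hlast hSne) hlo hcost (Or.inl (by omega))
    convert this using 1
    ring
  · have hQ : primeProd q S ≠ Q := fun he => hSu (h.primeProd_eq_iff.1 he)
    simp only [Counted.val_bind, Counted.cost_bind, cost_tick, OpCount.total, if_neg hQ]
    set a := (partialIdentity Q (List.ofFn q) (primeProd q S)).val with ha
    have hscale : (scale a c).val = a • c := rfl
    have hc' : IsColumnState K h j j S (a • c) :=
      hc.smul fun s => by rw [ha, h.proj_partialIdentity]
    obtain ⟨new, ht, lo, hlo, _, hlast, hcost⟩ :=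
      reduceColumn_spec hD (m + 1) (by omega) le_rfl hst hcol hc'
    rw [hscale]
    refine ⟨new, ht, ?_⟩
    have hborn : IsBornIn j
        (reduceColumn (List.ofFn q) j (m + 1) (primeProd q S) (a • c) st).val.output := by
      obtain ⟨s, hs⟩ : ∃ s, s ∉ S := by
        by_contra hall
        push Not at hall
        exact hSu (Finset.eq_univ_iff_forall.2 hall)
      rw [hmem, not_not] at hs
      obtain ⟨e, he, _⟩ := hs
      refine ⟨e.column, e.QT, ?_⟩
      rw [ht.output]
      exact List.mem_append_left _ ((hst.mem_coe _ _ _).2 ⟨e, he, rfl, rfl⟩)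
    have hpid := cost_partialIdentity_le Q (primeProd q S) (List.ofFn q)
    rw [List.length_ofFn, if_neg hQ] at hpid
    have := hfinish (y := 2 + (nnz c + ((partialIdentity Q (List.ofFn q) (primeProd q S)).cost +
      (scale a c).cost))) ht (hlast hSne) hlo hcost
      (Or.inr ⟨hborn, by rw [cost_scale]; omega⟩)
    convert this using 1
    ring

/-- The result and the cost of the treatment of a list of columns, in the right order. -/
theorem handleColumns_spec {D : ℕ} (hD : ∀ j, (K.simplex j).card ≤ D) (js : List (Fin m))
    (hjs : js.Pairwise K.TreatedBefore) {st : State m Q} (hst : StateInv K h st)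
    (hbefore : ∀ j ∈ js, ∀ k, ∀ e ∈ st.table k, K.TreatedBefore e.column j)
    (htop : ∀ j ∈ js, ∀ j' n, (j', (⊤ : WithTop (Fin m)), n) ∈ st.output → K.TreatedBefore j' j) :
    StateInv K h (handleColumns K (List.ofFn q) js st).val ∧
      (∀ j, j ∈ js ∨ st.Done q j → (handleColumns K (List.ofFn q) js st).val.Done q j) ∧
      (∃ new, (handleColumns K (List.ofFn q) js st).val.output = st.output ++ new) ∧
      ∃ f : Fin m → ℕ, (handleColumns K (List.ofFn q) js st).cost = (js.map f).sum ∧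
        ∀ j, ColumnCost D r Q (handleColumns K (List.ofFn q) js st).val.output j (f j) := by
  classical
  induction js generalizing st with
  | nil =>
    refine ⟨hst, fun j hj => hj.resolve_left (by simp), ⟨[], (List.append_nil _).symm⟩,
      fun _ => 0, rfl, fun j => Or.inl (Nat.zero_le _)⟩
  | cons j js ih =>
    obtain ⟨hj, hjs⟩ := List.pairwise_cons.1 hjs
    obtain ⟨new, ht, hcost⟩ := handleColumn_spec hD hst (hbefore j (List.mem_cons_self ..))
      (htop j (List.mem_cons_self ..))
    rw [handleColumns]
    simp only [Counted.val_bind, Counted.cost_bind]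
    set st' := (handleColumn K (List.ofFn q) j st).val
    obtain ⟨hinv, hdone, ⟨new', hout⟩, f, hf, hfcost⟩ := ih hjs ht.inv
      (fun j' hj' k e he => by
        rcases ht.column k e he with h₁ | h₁
        · exact h₁ ▸ hj j' hj'
        · exact h₁.trans (hj j' hj'))
      (fun j' hj' i n hn => by
        rcases ht.top i n hn with h₁ | h₁
        · exact h₁ ▸ hj j' hj'
        · exact h₁.trans (hj j' hj'))
    refine ⟨hinv, fun j' hj' => hdone j' ?_, ⟨new ++ new', ?_⟩,
      Function.update f j (handleColumn K (List.ofFn q) j st).cost, ?_, fun j' => ?_⟩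
    · rcases hj' with hj' | hj'
      · rcases List.mem_cons.1 hj' with rfl | hj'
        · exact Or.inr ht.done
        · exact Or.inl hj'
      · exact Or.inr (ht.done_mono hj')
    · rw [hout, ht.output, List.append_assoc]
    · rw [List.map_cons, List.sum_cons, Function.update_self, hf]
      congr 2
      exact List.map_congr_left fun j' hj' => (Function.update_of_ne (hj j' hj').ne.symm _ _).symm
    · by_cases hj' : j' = j
      · subst hj'
        rw [Function.update_self, hout]
        exact hcost.append new'
      · rw [Function.update_of_ne hj']
        exact hfcost j'

end Algorithm

/-! ### Correctness of the algorithm -/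

section Correctness

variable {m : ℕ} (K : FilteredComplex m)

theorem FilteredComplex.card_simplex_le (j : Fin m) : (K.simplex j).card ≤ m := by
  have hvert : ∀ v : K.simplex j, ∃ i, K.simplex i = {v.1} := by
    intro v
    rcases (Finset.singleton_subset_iff.2 v.2).eq_or_ssubset with he | hss
    · exact ⟨j, he.symm⟩
    · obtain ⟨i, _, hi⟩ := K.face_mem j _ (Finset.singleton_nonempty v.1) hss
      exact ⟨i, hi⟩
  choose g hg using hvert
  have hinj : Function.Injective g := fun v w hvw => by
    have := (hg v).symm.trans ((congrArg K.simplex hvw).trans (hg w))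
    exact Subtype.ext (Finset.singleton_injective this)
  simpa using Fintype.card_le_of_injective g hinj

theorem mem_columnOrder (j : Fin m) : j ∈ columnOrder K := by
  simp [columnOrder, K.card_simplex_le j]

theorem pairwise_columnOrder : (columnOrder K).Pairwise K.TreatedBefore := by
  rw [columnOrder, List.pairwise_flatMap]
  refine ⟨fun p _ => ?_, ?_⟩
  · refine List.Pairwise.imp_of_mem (fun {a b} ha hb hab => ?_)
      ((List.pairwise_lt_finRange m).filter _)
    simp only [List.mem_filter, decide_eq_true_eq] at ha hb
    exact Or.inr ⟨ha.2.trans hb.2.symm, hab⟩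
  · rw [List.pairwise_reverse]
    refine List.Pairwise.imp (fun {a b} hab x hx y hy => ?_) List.pairwise_lt_range
    simp only [List.mem_filter, decide_eq_true_eq] at hx hy
    exact Or.inl (by omega)

theorem nodup_columnOrder : (columnOrder K).Nodup :=
  (pairwise_columnOrder K).imp fun hab => hab.ne

variable {K} {r : ℕ} {q : Fin r → ℕ} {Q : ℕ} {h : IsPrimeFamily q Q}

theorem StateInv.eq_of_column_eq {st : State m Q} (hst : StateInv K h st) {k : Fin m}
    {e e' : Entry m Q} (he : e ∈ st.table k) (he' : e' ∈ st.table k)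
    (hcol : e.column = e'.column) : e = e' := by
  by_contra hne
  have hsym : Std.Symm fun e e' : Entry m Q => e.QT.Coprime e'.QT ∧ e.column ≠ e'.column :=
    ⟨fun _ _ hab => ⟨hab.1.symm, hab.2.symm⟩⟩
  exact ((hst.coprime k).forall he he' hne).2 hcol

theorem StateInv.eq_of_dvd {st : State m Q} (hst : StateInv K h st) {k : Fin m}
    {e e' : Entry m Q} (he : e ∈ st.table k) (he' : e' ∈ st.table k) {s : Fin r}
    (hs : q s ∣ e.QT) (hs' : q s ∣ e'.QT) : e = e' := by
  by_contra hne
  have hsym : Std.Symm fun e e' : Entry m Q => e.QT.Coprime e'.QT ∧ e.column ≠ e'.column :=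
    ⟨fun _ _ hab => ⟨hab.1.symm, hab.2.symm⟩⟩
  exact (h.prime s).not_dvd_one
    (((hst.coprime k).forall he he' hne).1 ▸ Nat.dvd_gcd hs hs')

/-- The entries of the table for the prime `q s`, as pairs of a row and a column. -/
def State.Pair (q : Fin r → ℕ) (st : State m Q) (s : Fin r) (k j : Fin m) : Prop :=
  ∃ e ∈ st.table k, e.column = j ∧ q s ∣ e.QT

/-- Once all the columns are treated, the table holds the outcome of a matrix reduction over each
of the fields.  A column that has been cleared is a birth index, and the reduced column that is
paired with it is a cycle. -/
theorem StateInv.isPairing {st : State m Q} (hst : StateInv K h st) (hdone : ∀ j, st.Done q j)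
    (s : Fin r) [Fact (q s).Prime] : K.IsPairing (ZMod (q s)) (st.Pair q s) := by
  have hcert : ∀ {k j}, st.Pair q s k j → ∃ v : Fin m → ZMod (q s), HasLow v j ∧
      HasLow (K.boundary (ZMod (q s)) v) k := by
    rintro k j ⟨e, he, rfl, hs⟩
    obtain ⟨T, hT⟩ := hst.entry k e he
    rw [hT.QT_eq, h.dvd_primeProd_iff] at hs
    obtain ⟨v, hv, hsupp, hu⟩ := hT.red
    have hb : ∀ i, K.boundary (ZMod (q s)) (fun l => h.proj s (v l)) i = h.proj s (e.vec i) :=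
      fun i => by rw [hv, K.map_boundary]
    refine ⟨fun l => h.proj s (v l), ⟨hu s hs, fun l hl => ?_⟩, ?_, fun i hi => ?_⟩
    · have : v l = 0 := by_contra fun hne => absurd (hsupp l hne).2.1 (not_le.2 hl)
      simp [this]
    · rw [hb, hT.one s hs]
      exact one_ne_zero
    · rw [hb, hT.above i hi, map_zero]
  refine ⟨hcert, ?_, fun j => ?_⟩
  · rintro k j j' ⟨e, he, rfl, hs⟩ ⟨e', he', rfl, hs'⟩
    rw [hst.eq_of_dvd he he' hs hs']
  · by_cases hd : st.Dead q s j
    · obtain ⟨k, e, he, hj, hs⟩ := hd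
      exact Or.inl ⟨k, e, he, hj, hs⟩
    refine Or.inr ?_
    by_cases hb : st.Born q s j
    · obtain ⟨e, he, hs⟩ := hb
      obtain ⟨v, _, hv⟩ := hcert (k := j) ⟨e, he, rfl, hs⟩
      exact ⟨_, hv, K.boundary_boundary _ v⟩
    · obtain ⟨n, hn⟩ := hdone j s hb hd
      obtain ⟨S, _, _, hmem, hcyc⟩ := hst.mem_top j n hn
      exact hcyc s ((hmem s).2 ⟨hb, hd⟩)

theorem StateInv.mem_output_iff {st : State m Q} (hst : StateInv K h st)
    (hdone : ∀ j, st.Done q j) (i : Fin m) (j : WithTop (Fin m)) (n : ℕ) :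
    (i, j, n) ∈ st.output ↔ ∃ S, (i, j, S) ∈ K.multiDiagram q ∧ n = primeProd q S := by
  have hfact : ∀ s, Fact (q s).Prime := fun s => ⟨h.prime s⟩
  have hcoe : ∀ s (j : Fin m), (i, (j : WithTop (Fin m))) ∈ K.diagram (ZMod (q s)) ↔
      st.Pair q s i j := fun s j => (hst.isPairing hdone s).mem_diagram_coe i j
  have htop : ∀ s, (i, (⊤ : WithTop (Fin m))) ∈ K.diagram (ZMod (q s)) ↔
      ¬ st.Born q s i ∧ ¬ st.Dead q s i := by
    intro s
    rw [(hst.isPairing hdone s).mem_diagram_top i, and_comm]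
    refine and_congr (not_congr ⟨?_, ?_⟩) Iff.rfl
    · exact fun ⟨_, e, he, _, hs⟩ => ⟨e, he, hs⟩
    · exact fun ⟨e, he, hs⟩ => ⟨_, e, he, rfl, hs⟩
  simp only [FilteredComplex.multiDiagram, Finset.mem_filter, Finset.mem_univ, true_and]
  induction j using WithTop.recTopCoe with
  | top =>
    constructor
    · intro hn
      obtain ⟨S, hne, rfl, hmem, _⟩ := hst.mem_top i n hn
      exact ⟨S, ⟨hne, fun s => (hmem s).trans (htop s).symm⟩, rfl⟩
    · rintro ⟨S, ⟨⟨s, hs⟩, hmem⟩, rfl⟩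
      obtain ⟨hb, hd⟩ := (htop s).1 ((hmem s).1 hs)
      obtain ⟨n, hn⟩ := hdone i s hb hd
      obtain ⟨S', _, rfl, hmem', _⟩ := hst.mem_top i n hn
      obtain rfl : S' = S := by
        ext s
        rw [hmem, htop, hmem']
      exact hn
  | coe j =>
    have hT : ∀ e ∈ st.table i, e.column = j → ∀ s, st.Pair q s i j ↔ q s ∣ e.QT := by
      intro e he hej s
      constructor
      · rintro ⟨e', he', hej', hs⟩
        rwa [hst.eq_of_column_eq he he' (hej.trans hej'.symm)]
      · exact fun hs => ⟨e, he, hej, hs⟩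
    rw [hst.mem_coe]
    constructor
    · rintro ⟨e, he, hej, rfl⟩
      obtain ⟨T, hT'⟩ := hst.entry i e he
      refine ⟨T, ⟨hT'.nonempty, fun s => ?_⟩, hT'.QT_eq⟩
      rw [hcoe, hT e he hej, hT'.QT_eq, h.dvd_primeProd_iff]
    · rintro ⟨S, ⟨⟨s, hs⟩, hmem⟩, rfl⟩
      obtain ⟨e, he, hej, _⟩ := (hcoe s j).1 ((hmem s).1 hs)
      obtain ⟨T, hT'⟩ := hst.entry i e he
      refine ⟨e, he, hej, hT'.QT_eq.trans (congrArg _ ?_)⟩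
      ext s
      rw [hmem, hcoe, hT e he hej, hT'.QT_eq, h.dvd_primeProd_iff]

theorem stateInv_init (K : FilteredComplex m) (h : IsPrimeFamily q Q) :
    StateInv K h ({ table := fun _ => [], open_ := fun _ => Q, output := [] } : State m Q) :=
  ⟨by simp, by simp, fun _ => ⟨Finset.univ, h.primeProd_univ.symm, by simp [State.Born]⟩, by simp,
    List.nodup_nil, by simp, by simp⟩

/-- The result and the cost of the algorithm, in terms of the triples that it outputs. -/
theorem modularReconstruction_spec {D : ℕ} (hD : ∀ j, (K.simplex j).card ≤ D)
    (h : IsPrimeFamily q (∏ s, q s)) :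
    (modularReconstruction K q).val.Nodup ∧
    (∀ i j n, (i, j, n) ∈ (modularReconstruction K q).val ↔
      ∃ S, (i, j, S) ∈ K.multiDiagram q ∧ n = primeProd q S) ∧
    (∀ s, ∃ pair, ∃ _ : Fact (q s).Prime, K.IsPairing (ZMod (q s)) pair) ∧
    ∃ f : Fin m → ℕ, (modularReconstruction K q).cost = 5 * m + ∑ j, f j ∧
      ∀ j, ColumnCost D r (∏ s, q s) (modularReconstruction K q).val j (f j) := by
  obtain ⟨hst, hdone, _, f, hf, hcost⟩ := handleColumns_spec hD (columnOrder K)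
    (pairwise_columnOrder K) (stateInv_init K h) (by simp) (by simp)
  have hdone' := fun j => hdone j (Or.inl (mem_columnOrder K j))
  refine ⟨hst.nodup, hst.mem_output_iff hdone',
    fun s => ⟨_, ⟨h.prime s⟩, have : Fact (q s).Prime := ⟨h.prime s⟩; hst.isPairing hdone' s⟩,
    f, ?_, hcost⟩
  rw [modularReconstruction]
  simp only [Counted.cost_bind, Counted.cost_pure, cost_tick, OpCount.total, hf]
  rw [← List.sum_toFinset f (nodup_columnOrder K),
    show (columnOrder K).toFinset = Finset.univ from
      Finset.eq_univ_iff_forall.2 fun j => List.mem_toFinset.2 (mem_columnOrder K j)]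
  ring

end Correctness

/-! ### Counting intervals -/

section Touching

variable {m : ℕ} {K : FilteredComplex m} {F : Type} [Field F] {pair : Fin m → Fin m → Prop}

/-- The index `j` is an endpoint of the interval. -/
def Touches (i : Fin m) (i' : WithTop (Fin m)) (j : Fin m) : Prop :=
  i = j ∨ i' = (j : WithTop (Fin m))

theorem FilteredComplex.IsPairing.exists_touches (hp : K.IsPairing F pair) (j : Fin m) :
    ∃ i i', (i, i') ∈ K.diagram F ∧ Touches i i' j := by
  by_cases h₁ : ∃ k, pair k j
  · obtain ⟨k, hk⟩ := h₁
    exact ⟨k, j, (hp.mem_diagram_coe k j).2 hk, Or.inr rfl⟩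
  by_cases h₂ : ∃ j', pair j j'
  · obtain ⟨j', hj'⟩ := h₂
    exact ⟨j, j', (hp.mem_diagram_coe j j').2 hj', Or.inl rfl⟩
  · exact ⟨j, ⊤, (hp.mem_diagram_top j).2 ⟨h₁, h₂⟩, Or.inl rfl⟩

/-- Each index is the endpoint of one interval only. -/
theorem FilteredComplex.IsPairing.eq_of_touches (hp : K.IsPairing F pair) {j : Fin m}
    {i l : Fin m} {i' l' : WithTop (Fin m)} (hi : (i, i') ∈ K.diagram F)
    (hl : (l, l') ∈ K.diagram F) (hij : Touches i i' j) (hlj : Touches l l' j) :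
    i = l ∧ i' = l' := by
  induction i' using WithTop.recTopCoe with
  | top =>
    obtain rfl : i = j := hij.resolve_right (by simp)
    have hi := (hp.mem_diagram_top i).1 hi
    induction l' using WithTop.recTopCoe with
    | top => exact ⟨(hlj.resolve_right (by simp)).symm, rfl⟩
    | coe l' =>
      have hl := (hp.mem_diagram_coe l l').1 hl
      rcases hlj with rfl | he
      · exact absurd ⟨l', hl⟩ hi.2
      · rw [WithTop.coe_inj] at he
        exact absurd ⟨l, he ▸ hl⟩ hi.1
  | coe i' =>
    have hi := (hp.mem_diagram_coe i i').1 hi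
    induction l' using WithTop.recTopCoe with
    | top =>
      obtain rfl : l = j := hlj.resolve_right (by simp)
      have hl := (hp.mem_diagram_top l).1 hl
      rcases hij with rfl | he
      · exact absurd ⟨i', hi⟩ hl.2
      · rw [WithTop.coe_inj] at he
        exact absurd ⟨i, he ▸ hi⟩ hl.1
    | coe l' =>
      have hl := (hp.mem_diagram_coe l l').1 hl
      simp only [Touches, WithTop.coe_inj] at hij hlj ⊢
      rcases hij with rfl | rfl <;> rcases hlj with rfl | rfl
      · exact ⟨rfl, hp.inj hi hl⟩
      · exact absurd hl (hp.not_pair_of_pair hi)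
      · exact absurd hi (hp.not_pair_of_pair hl)
      · exact ⟨hp.unique_left hi hl, rfl⟩

end Touching

section Counting

open Classical

variable {m r : ℕ} (K : FilteredComplex m) (q : Fin r → ℕ)

/-- The intervals over each of the fields come from a pairing of the simplices. -/
def FilteredComplex.IsPaired : Prop :=
  ∀ s, ∃ pair, ∃ _ : Fact (q s).Prime, K.IsPairing (ZMod (q s)) pair

variable {K q}

theorem mem_multiDiagram {t : Fin m × WithTop (Fin m) × Finset (Fin r)} :
    t ∈ K.multiDiagram q ↔
      t.2.2.Nonempty ∧ ∀ s, s ∈ t.2.2 ↔ (t.1, t.2.1) ∈ K.diagram (ZMod (q s)) := by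
  simp [FilteredComplex.multiDiagram]

theorem exists_mem_multiDiagram {s : Fin r} {i : Fin m} {i' : WithTop (Fin m)}
    (hi : (i, i') ∈ K.diagram (ZMod (q s))) :
    ∃ S, s ∈ S ∧ (i, i', S) ∈ K.multiDiagram q := by
  refine ⟨Finset.univ.filter fun s => (i, i') ∈ K.diagram (ZMod (q s)), by simpa using hi, ?_⟩
  rw [mem_multiDiagram]
  exact ⟨⟨s, by simpa using hi⟩, by simp⟩

theorem eq_of_mem_multiDiagram {t t' : Fin m × WithTop (Fin m) × Finset (Fin r)}
    (ht : t ∈ K.multiDiagram q) (ht' : t' ∈ K.multiDiagram q) (h₁ : t.1 = t'.1)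
    (h₂ : t.2.1 = t'.2.1) : t = t' := by
  obtain ⟨i, j, S⟩ := t
  obtain ⟨i', j', S'⟩ := t'
  obtain rfl : i = i' := h₁
  obtain rfl : j = j' := h₂
  rw [mem_multiDiagram] at ht ht'
  have : S = S' := by
    ext s
    rw [ht.2 s, ht'.2 s]
  rw [this]

theorem card_filter_mem_multiDiagram (s₀ : Fin r) :
    ((K.multiDiagram q).filter fun t => s₀ ∈ t.2.2).card = (K.diagram (ZMod (q s₀))).card := by
  refine Finset.card_bij (fun t _ => (t.1, t.2.1)) (fun t ht => ?_) (fun t ht t' ht' he => ?_)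
    (fun p hp => ?_)
  · rw [Finset.mem_filter] at ht
    exact ((mem_multiDiagram.1 ht.1).2 s₀).1 ht.2
  · rw [Prod.mk.injEq] at he
    exact eq_of_mem_multiDiagram (Finset.mem_filter.1 ht).1 (Finset.mem_filter.1 ht').1 he.1 he.2
  · obtain ⟨S, hs, hS⟩ := exists_mem_multiDiagram hp
    exact ⟨_, Finset.mem_filter.2 ⟨hS, hs⟩, rfl⟩

/-- The number of triples that do not concern the prime `q s₀`. -/
theorem card_filter_notMem_multiDiagram (s₀ : Fin r) :
    (((K.multiDiagram q).filter fun t => s₀ ∉ t.2.2).card : ℝ) =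
      (K.multiDiagram q).card - (K.diagram (ZMod (q s₀))).card := by
  rw [← card_filter_mem_multiDiagram s₀,
    ← Finset.card_filter_add_card_filter_not (s := K.multiDiagram q) (fun t => s₀ ∈ t.2.2)]
  push_cast
  ring

/-- The endpoints of the triples that do not concern the prime `q s₀`. -/
theorem card_touched_le (s₀ : Fin r) :
    (Finset.univ.filter fun j : Fin m =>
      ∃ t ∈ K.multiDiagram q, s₀ ∉ t.2.2 ∧ Touches t.1 t.2.1 j).card ≤
        2 * ((K.multiDiagram q).filter fun t => s₀ ∉ t.2.2).card := by
  set N := (K.multiDiagram q).filter fun t => s₀ ∉ t.2.2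
  calc _ ≤ (N.image (fun t => t.1) ∪ N.image (fun t => t.2.1.untopD t.1)).card := by
        refine Finset.card_le_card fun j hj => ?_
        obtain ⟨t, ht, hs, hj⟩ := (Finset.mem_filter.1 hj).2
        have htN : t ∈ N := Finset.mem_filter.2 ⟨ht, hs⟩
        rw [Finset.mem_union]
        rcases hj with hj | hj
        · exact Or.inl (Finset.mem_image.2 ⟨t, htN, hj⟩)
        · exact Or.inr (Finset.mem_image.2 ⟨t, htN, by rw [hj]; rfl⟩)
    _ ≤ N.card + N.card :=
        (Finset.card_union_le _ _).trans (Nat.add_le_add Finset.card_image_le Finset.card_image_le)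
    _ = _ := by ring

namespace FilteredComplex.IsPaired

variable (hK : K.IsPaired q)
include hK

theorem exists_touches (s : Fin r) (j : Fin m) :
    ∃ t ∈ K.multiDiagram q, s ∈ t.2.2 ∧ Touches t.1 t.2.1 j := by
  obtain ⟨pair, _, hp⟩ := hK s
  obtain ⟨i, i', hi, hj⟩ := hp.exists_touches j
  obtain ⟨S, hs, hS⟩ := exists_mem_multiDiagram hi
  exact ⟨_, hS, hs, hj⟩

theorem eq_of_touches {s : Fin r} {j : Fin m} {t t' : Fin m × WithTop (Fin m) × Finset (Fin r)}
    (ht : t ∈ K.multiDiagram q) (ht' : t' ∈ K.multiDiagram q) (hs : s ∈ t.2.2) (hs' : s ∈ t'.2.2)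
    (hj : Touches t.1 t.2.1 j) (hj' : Touches t'.1 t'.2.1 j) : t = t' := by
  obtain ⟨pair, _, hp⟩ := hK s
  obtain ⟨h₁, h₂⟩ := hp.eq_of_touches (((mem_multiDiagram.1 ht).2 s).1 hs)
    (((mem_multiDiagram.1 ht').2 s).1 hs') hj hj'
  exact eq_of_mem_multiDiagram ht ht' h₁ h₂

theorem lt {i j : Fin m} {S : Finset (Fin r)}
    (ht : (i, (j : WithTop (Fin m)), S) ∈ K.multiDiagram q) : i < j := by
  obtain ⟨⟨s, hs⟩, hmem⟩ := mem_multiDiagram.1 ht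
  obtain ⟨pair, _, hp⟩ := hK s
  exact hp.lt ((hp.mem_diagram_coe i j).1 ((hmem s).1 hs))

/-- An endpoint of a triple that concerns some of the primes only is also an endpoint of a triple
that does not concern `q s₀`. -/
theorem exists_touches_of_ne_univ (s₀ : Fin r) {t : Fin m × WithTop (Fin m) × Finset (Fin r)}
    (ht : t ∈ K.multiDiagram q) (hu : t.2.2 ≠ Finset.univ) {j : Fin m}
    (hj : Touches t.1 t.2.1 j) :
    ∃ t' ∈ K.multiDiagram q, s₀ ∉ t'.2.2 ∧ Touches t'.1 t'.2.1 j := by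
  by_cases hs₀ : s₀ ∈ t.2.2
  swap
  · exact ⟨t, ht, hs₀, hj⟩
  obtain ⟨s, hs⟩ : ∃ s, s ∉ t.2.2 := by
    by_contra hall
    push Not at hall
    exact hu (Finset.eq_univ_iff_forall.2 hall)
  obtain ⟨t', ht', hs', hj'⟩ := hK.exists_touches s j
  refine ⟨t', ht', fun hs₀' => hs ?_, hj'⟩
  rwa [hK.eq_of_touches ht ht' hs₀ hs₀' hj hj']

/-- The number of finite intervals that exist for some of the primes only. -/
theorem sum_card_filter_ne_univ_le (s₀ : Fin r) :
    ∑ j : Fin m, ((K.multiDiagram q).filter fun t =>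
      t.2.1 = (j : WithTop (Fin m)) ∧ t.2.2 ≠ Finset.univ).card ≤
        3 * ((K.multiDiagram q).filter fun t => s₀ ∉ t.2.2).card := by
  set N := (K.multiDiagram q).filter fun t => s₀ ∉ t.2.2
  set J := Finset.univ.filter fun j : Fin m =>
      ∃ t ∈ K.multiDiagram q, s₀ ∉ t.2.2 ∧ Touches t.1 t.2.1 j
  have hJ : J.card ≤ 2 * N.card := card_touched_le s₀
  -- At each death index, at most one triple concerns `q s₀`.
  have hone : ∀ j : Fin m, ((K.multiDiagram q).filter fun t =>
      t.2.1 = (j : WithTop (Fin m)) ∧ t.2.2 ≠ Finset.univ).card ≤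
        (N.filter fun t => t.2.1 = (j : WithTop (Fin m))).card + if j ∈ J then 1 else 0 := by
    intro j
    set X := (K.multiDiagram q).filter fun t =>
      t.2.1 = (j : WithTop (Fin m)) ∧ t.2.2 ≠ Finset.univ
    rw [← Finset.card_filter_add_card_filter_not (s := X) (fun t => s₀ ∉ t.2.2)]
    refine Nat.add_le_add (Finset.card_le_card fun t ht => ?_) ?_
    · simp only [X, N, Finset.mem_filter] at ht ⊢
      exact ⟨⟨ht.1.1, ht.2⟩, ht.1.2.1⟩
    · have hle : (X.filter fun t => ¬ s₀ ∉ t.2.2).card ≤ 1 := by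
        rw [Finset.card_le_one]
        intro t ht t' ht'
        simp only [X, Finset.mem_filter, not_not] at ht ht'
        exact hK.eq_of_touches ht.1.1 ht'.1.1 ht.2 ht'.2 (Or.inr ht.1.2.1) (Or.inr ht'.1.2.1)
      split_ifs with hj
      · exact hle
      · rw [Nat.le_zero, Finset.card_eq_zero, Finset.filter_eq_empty_iff]
        intro t ht _
        simp only [X, Finset.mem_filter] at ht
        exact hj (Finset.mem_filter.2 ⟨Finset.mem_univ j,
          hK.exists_touches_of_ne_univ s₀ ht.1 ht.2.2 (Or.inr ht.2.1)⟩)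
  have hN : ∑ j : Fin m, (N.filter fun t => t.2.1 = (j : WithTop (Fin m))).card ≤ N.card := by
    rw [← Finset.card_biUnion]
    · exact Finset.card_le_card (Finset.biUnion_subset.2 fun j _ => Finset.filter_subset _ _)
    · intro j _ j' _ hne
      refine Finset.disjoint_left.2 fun t ht ht' => hne ?_
      have := (Finset.mem_filter.1 ht).2.symm.trans (Finset.mem_filter.1 ht').2
      exact WithTop.coe_inj.1 this
  have hsum := Finset.sum_le_sum fun j (_ : j ∈ Finset.univ) => hone j
  rw [Finset.sum_add_distrib, Finset.sum_boole] at hsum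
  simp only [Finset.filter_univ_mem, Nat.cast_id] at hsum
  omega

/-- A common endpoint of two triples, such as a column that is cleared for some of the primes only, is
an endpoint of a triple that does not concern `q s₀`. -/
theorem exists_touches_of_ne (s₀ : Fin r) {t t' : Fin m × WithTop (Fin m) × Finset (Fin r)}
    (ht : t ∈ K.multiDiagram q) (ht' : t' ∈ K.multiDiagram q) (hne : t ≠ t') {j : Fin m}
    (hj : Touches t.1 t.2.1 j) (hj' : Touches t'.1 t'.2.1 j) :
    ∃ t ∈ K.multiDiagram q, s₀ ∉ t.2.2 ∧ Touches t.1 t.2.1 j := by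
  by_cases hs : s₀ ∈ t.2.2
  · exact ⟨t', ht', fun hs' => hne (hK.eq_of_touches ht ht' hs hs' hj hj'), hj'⟩
  · exact ⟨t, ht, hs, hj⟩

/-- Each simplex is an endpoint of an interval over each of the fields. -/
theorem le_two_mul_card (s₀ : Fin r) : m ≤ 2 * (K.multiDiagram q).card := by
  calc m = (Finset.univ : Finset (Fin m)).card := (Finset.card_fin m).symm
    _ ≤ ((K.multiDiagram q).image (fun t => t.1) ∪
          (K.multiDiagram q).image (fun t => t.2.1.untopD t.1)).card := by
        refine Finset.card_le_card fun j _ => ?_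
        obtain ⟨t, ht, _, hj⟩ := hK.exists_touches s₀ j
        rw [Finset.mem_union]
        rcases hj with hj | hj
        · exact Or.inl (Finset.mem_image.2 ⟨t, ht, hj⟩)
        · exact Or.inr (Finset.mem_image.2 ⟨t, ht, by rw [hj]; rfl⟩)
    _ ≤ (K.multiDiagram q).card + (K.multiDiagram q).card :=
        (Finset.card_union_le _ _).trans (Nat.add_le_add Finset.card_image_le Finset.card_image_le)
    _ = _ := by ring

end FilteredComplex.IsPaired

end Counting

/-! ### Summation of the costs -/

section Summation

open Classical

variable {m r : ℕ} (K : FilteredComplex m) (q : Fin r → ℕ)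

/-- The sum of the lengths of the intervals that die at `j`. -/
noncomputable def dyingLength (j : Fin m) : ℕ :=
  ∑ t ∈ (K.multiDiagram q).filter (fun t => t.2.1 = (j : WithTop (Fin m))), ((j : ℕ) - t.1)

/-- The share of column `j` in the bound on the running time: that of the intervals that die at `j`
and that of the infinite intervals born at `j`. -/
noncomputable def columnBudget (j : Fin m) : ℕ :=
  (∑ t ∈ (K.multiDiagram q).filter (fun t => t.2.1 = (j : WithTop (Fin m))),
    ((j : ℕ) - t.1) ^ 2 * K.numDying q j) +
  ∑ _t ∈ (K.multiDiagram q).filter (fun t => t.2.1 = ⊤ ∧ t.1 = j),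
    ((j : ℕ) + 1) ^ 2 * max 1 (K.numDying q j)

/-- The sum of `dyingLength` over the columns `j'` before `j` whose value exceeds `j - j'`. -/
noncomputable def excess (j : Fin m) : ℕ :=
  ∑ j' ∈ Finset.univ.filter (fun j' : Fin m => j' < j ∧ (j : ℕ) < j' + dyingLength K q j'),
    dyingLength K q j'

variable {K q}

theorem numDying_eq (j : Fin m) : K.numDying q j =
    ((K.multiDiagram q).filter (fun t => t.2.1 = (j : WithTop (Fin m)))).card := by
  rw [FilteredComplex.numDying]

/-- This is the Cauchy-Schwarz inequality. -/
theorem dyingLength_sq_le (j : Fin m) : dyingLength K q j ^ 2 ≤ columnBudget K q j := by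
  refine le_trans ?_ (Nat.le_add_right _ _)
  rw [← Finset.sum_mul, mul_comm, numDying_eq]
  exact sq_sum_le_card_mul_sum_sq

theorem card_filter_lt_lt_le (a b : ℕ) :
    (Finset.univ.filter (fun j : Fin m => a < (j : ℕ) ∧ (j : ℕ) < b)).card ≤ b - a := by
  calc _ ≤ (Finset.Ico a b).card :=
        Finset.card_le_card_of_injOn (fun j : Fin m => (j : ℕ)) (fun j hj => by
          have := (Finset.mem_filter.1 hj).2
          exact Finset.mem_coe.2 (Finset.mem_Ico.2 ⟨this.1.le, this.2⟩))
          (fun a _ b _ hab => Fin.ext hab)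
    _ = _ := Nat.card_Ico a b

/-- The value `dyingLength K q j'` enters `excess K q j` for at most `dyingLength K q j'` indices
`j`. -/
theorem sum_excess_le : ∑ j, excess K q j ≤ ∑ j, columnBudget K q j := by
  calc ∑ j, excess K q j
      = ∑ j', ∑ j : Fin m, if j' < j ∧ (j : ℕ) < j' + dyingLength K q j'
          then dyingLength K q j' else 0 := by
        simp only [excess, Finset.sum_filter]
        exact Finset.sum_comm
    _ ≤ ∑ j', dyingLength K q j' ^ 2 := by
        refine Finset.sum_le_sum fun j' _ => ?_
        rw [← Finset.sum_filter, Finset.sum_const, smul_eq_mul, sq]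
        refine Nat.mul_le_mul_right _ ?_
        have := card_filter_lt_lt_le (m := m) j' (j' + dyingLength K q j')
        rwa [Nat.add_sub_cancel_left] at this
    _ ≤ _ := Finset.sum_le_sum fun j' _ => dyingLength_sq_le j'

/-- The columns `j'` in `(lo, j)` with `dyingLength K q j' ≤ j - j'` contribute at most `n` each,
and the others make up `excess K q j`. -/
theorem sum_scanWeight_le {j : Fin m} {lo n : ℕ} (hn : (j : ℕ) - lo ≤ n)
    (g : Finset (Fin r) → ℕ) :
    ∑ t ∈ K.multiDiagram q, scanWeight j lo j (t.1, t.2.1, g t.2.2) ≤ n ^ 2 + excess K q j := by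
  set I := Finset.univ.filter (fun j' : Fin m => lo < (j' : ℕ) ∧ (j' : ℕ) < j)
  calc _ ≤ ∑ t ∈ K.multiDiagram q, ∑ j' ∈ I,
          if t.2.1 = (j' : WithTop (Fin m)) then (j' : ℕ) - t.1 else 0 := by
        refine Finset.sum_le_sum fun t _ => ?_
        obtain ⟨i, i', S⟩ := t
        rw [scanWeight]
        dsimp only
        split_ifs with hi
        swap
        · exact Nat.zero_le _
        induction i' using WithTop.recTopCoe with
        | top => exact Nat.zero_le _
        | coe j' =>
          rw [WithTop.recTopCoe_coe]
          split_ifs with hj'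
          swap
          · exact Nat.zero_le _
          by_cases hij : (i : ℕ) < j'
          · have hmem : j' ∈ I := Finset.mem_filter.2 ⟨Finset.mem_univ _, by omega, hj'⟩
            refine le_trans (le_of_eq ?_) (Finset.single_le_sum (fun _ _ => Nat.zero_le _) hmem)
            rw [if_pos rfl]
          · rw [Nat.sub_eq_zero_of_le (not_lt.1 hij)]
            exact Nat.zero_le _
    _ = ∑ j' ∈ I, dyingLength K q j' := by
        rw [Finset.sum_comm]
        refine Finset.sum_congr rfl fun j' _ => ?_
        rw [dyingLength, Finset.sum_filter]
    _ ≤ ∑ j' ∈ I, (n + if (j : ℕ) < j' + dyingLength K q j' then dyingLength K q j' else 0) := by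
        refine Finset.sum_le_sum fun j' hj' => ?_
        have := (Finset.mem_filter.1 hj').2
        split_ifs <;> omega
    _ ≤ _ := by
        rw [Finset.sum_add_distrib, Finset.sum_const, smul_eq_mul, sq, ← Finset.sum_filter]
        refine Nat.add_le_add (Nat.mul_le_mul_right _ ((card_filter_lt_lt_le _ _).trans hn))
          (Finset.sum_le_sum_of_subset fun j' hj' => ?_)
        simp only [I, Finset.mem_filter, Finset.mem_univ, true_and] at hj' ⊢
        exact ⟨hj'.1.2, hj'.2⟩

/-- The number `n` of rows that the reduction of column `j` may go through is covered by the budget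
of the column. -/
theorem exists_sq_mul_le_columnBudget (hK : K.IsPaired q) {j : Fin m} {lo : ℕ}
    (hlo : (lo = 0 ∧ ∃ S, (j, (⊤ : WithTop (Fin m)), S) ∈ K.multiDiagram q) ∨
      ∃ (k : Fin m) (S : Finset (Fin r)), (k : ℕ) = lo ∧ (k, (j : WithTop (Fin m)), S) ∈ K.multiDiagram q) :
    ∃ n, 1 ≤ n ∧ (j : ℕ) - lo ≤ n ∧ (j : ℕ) + 1 - lo ≤ 2 * n ∧
      n ^ 2 * max 1 (K.numDying q j) ≤ columnBudget K q j := by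
  rcases hlo with ⟨rfl, S, hS⟩ | ⟨k, S, rfl, hS⟩
  · refine ⟨j + 1, by omega, by omega, by omega, le_trans ?_ (Nat.le_add_left _ _)⟩
    exact Finset.single_le_sum
      (f := fun _ => ((j : ℕ) + 1) ^ 2 * max 1 (K.numDying q j)) (fun _ _ => Nat.zero_le _)
      (Finset.mem_filter.2 ⟨hS, rfl, rfl⟩)
  · have hlt : (k : ℕ) < j := hK.lt hS
    have hmem : (k, (j : WithTop (Fin m)), S) ∈
        (K.multiDiagram q).filter (fun t => t.2.1 = (j : WithTop (Fin m))) :=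
      Finset.mem_filter.2 ⟨hS, rfl⟩
    have hpos : 1 ≤ K.numDying q j := by
      rw [numDying_eq]
      exact Finset.card_pos.2 ⟨_, hmem⟩
    refine ⟨j - k, by omega, le_rfl, by omega, le_trans ?_ (Nat.le_add_right _ _)⟩
    rw [max_eq_right hpos]
    exact Finset.single_le_sum
      (f := fun t : Fin m × WithTop (Fin m) × Finset (Fin r) =>
        ((j : ℕ) - t.1) ^ 2 * K.numDying q j) (fun _ _ => Nat.zero_le _) hmem

theorem card_multiDiagram_le (hK : K.IsPaired q) :
    (K.multiDiagram q).card ≤ ∑ j, columnBudget K q j := by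
  have hcover : K.multiDiagram q ⊆ Finset.univ.biUnion fun j : Fin m =>
      (K.multiDiagram q).filter (fun t => t.2.1 = (j : WithTop (Fin m))) ∪
        (K.multiDiagram q).filter (fun t => t.2.1 = ⊤ ∧ t.1 = j) := by
    rintro ⟨i, i', S⟩ ht
    simp only [Finset.mem_biUnion, Finset.mem_univ, true_and, Finset.mem_union, Finset.mem_filter]
    induction i' using WithTop.recTopCoe with
    | top => exact ⟨i, Or.inr ⟨ht, rfl, rfl⟩⟩
    | coe j => exact ⟨j, Or.inl ⟨ht, rfl⟩⟩
  refine (Finset.card_le_card hcover).trans (Finset.card_biUnion_le.trans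
    (Finset.sum_le_sum fun j _ => (Finset.card_union_le _ _).trans (Nat.add_le_add ?_ ?_)))
  · rw [Finset.card_eq_sum_ones]
    refine Finset.sum_le_sum fun t ht => ?_
    obtain ⟨ht', hj⟩ := Finset.mem_filter.1 ht
    have hlt : (t.1 : ℕ) < j := hK.lt (S := t.2.2) (by rw [← hj]; exact ht')
    refine Nat.mul_pos (pow_pos (by omega) 2) ?_
    rw [numDying_eq]
    exact Finset.card_pos.2 ⟨t, ht⟩
  · rw [Finset.card_eq_sum_ones]
    exact Finset.sum_le_sum fun t _ => Nat.mul_pos (pow_pos (by omega) 2)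
      (lt_of_lt_of_le one_pos (le_max_left _ _))

section Output

variable {l : List (Fin m × WithTop (Fin m) × ℕ)}

/-- Sums over the triples in the output are sums over the multi-field diagram. -/
theorem sum_map_eq_sum_multiDiagram {Q : ℕ} (h : IsPrimeFamily q Q) (hl : l.Nodup)
    (hmem : ∀ i j n, (i, j, n) ∈ l ↔ ∃ S, (i, j, S) ∈ K.multiDiagram q ∧ n = primeProd q S)
    (f : Fin m × WithTop (Fin m) × ℕ → ℕ) :
    (l.map f).sum = ∑ t ∈ K.multiDiagram q, f (t.1, t.2.1, primeProd q t.2.2) := by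
  have himage : l.toFinset =
      (K.multiDiagram q).image fun t => (t.1, t.2.1, primeProd q t.2.2) := by
    ext ⟨i, j, n⟩
    rw [List.mem_toFinset, hmem, Finset.mem_image]
    constructor
    · rintro ⟨S, hS, rfl⟩
      exact ⟨_, hS, rfl⟩
    · rintro ⟨⟨i', j', S⟩, hS, he⟩
      simp only [Prod.mk.injEq] at he
      obtain ⟨rfl, rfl, rfl⟩ := he
      exact ⟨S, hS, rfl⟩
  rw [← List.sum_toFinset f hl, himage, Finset.sum_image]
  rintro ⟨i, j, S⟩ _ ⟨i', j', S'⟩ _ he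
  simp only [Prod.mk.injEq] at he ⊢
  exact ⟨he.1, he.2.1, h.primeProd_injective he.2.2⟩

theorem countP_eq_card_filter {Q : ℕ} (h : IsPrimeFamily q Q) (hl : l.Nodup)
    (hmem : ∀ i j n, (i, j, n) ∈ l ↔ ∃ S, (i, j, S) ∈ K.multiDiagram q ∧ n = primeProd q S)
    (p : Fin m × WithTop (Fin m) × ℕ → Prop) [DecidablePred p] :
    l.countP (fun t => p t) =
      ((K.multiDiagram q).filter fun t => p (t.1, t.2.1, primeProd q t.2.2)).card := by
  rw [Finset.card_filter, ← sum_map_eq_sum_multiDiagram h hl hmem (fun t => if p t then 1 else 0)]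
  clear hl hmem
  induction l with
  | nil => rfl
  | cons t l ih =>
    rw [List.countP_cons, ih, List.map_cons, List.sum_cons, add_comm]
    simp

/-- The cost of a column, in terms of the multi-field diagram. -/
theorem ColumnCost.le {Q D x : ℕ} {j : Fin m} (hx : ColumnCost D r Q l j x)
    (h : IsPrimeFamily q Q) (hl : l.Nodup)
    (hmem : ∀ i j n, (i, j, n) ∈ l ↔ ∃ S, (i, j, S) ∈ K.multiDiagram q ∧ n = primeProd q S)
    (hK : K.IsPaired q) (hD : 1 ≤ D) (s₀ : Fin r) :
    x ≤ 2 + 7 * D * excess K q j + 59 * D * columnBudget K q j +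
      6 * r * (((K.multiDiagram q).filter fun t =>
          t.2.1 = (j : WithTop (Fin m)) ∧ t.2.2 ≠ Finset.univ).card +
        if ∃ t ∈ K.multiDiagram q, s₀ ∉ t.2.2 ∧ Touches t.1 t.2.1 j then 1 else 0) := by
  rcases hx with hx | ⟨lo, hlo, hlast, hx⟩
  · exact hx.trans (by omega)
  have hlast' : (lo = 0 ∧ ∃ S, (j, (⊤ : WithTop (Fin m)), S) ∈ K.multiDiagram q) ∨
      ∃ (k : Fin m) (S : Finset (Fin r)), (k : ℕ) = lo ∧ (k, (j : WithTop (Fin m)), S) ∈ K.multiDiagram q := by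
    rcases hlast with ⟨h0, n, hn⟩ | ⟨k, n, hk, hn⟩
    · obtain ⟨S, hS, _⟩ := (hmem _ _ _).1 hn
      exact Or.inl ⟨h0, S, hS⟩
    · obtain ⟨S, hS, _⟩ := (hmem _ _ _).1 hn
      exact Or.inr ⟨k, S, hk, hS⟩
  obtain ⟨n, hn, hjn, hjn', hbudget⟩ := exists_sq_mul_le_columnBudget hK hlast'
  set W := columnBudget K q j
  have hscan : scanSum j lo j l ≤ n ^ 2 + excess K q j := by
    rw [scanSum, sum_map_eq_sum_multiDiagram h hl hmem]
    exact sum_scanWeight_le hjn _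
  have hdying : countDying j l = K.numDying q j := by
    rw [countDying, countP_eq_card_filter h hl hmem
      (fun t => t.2.1 = (j : WithTop (Fin m))), numDying_eq]
  have hpartial : countPartialDying Q j l = ((K.multiDiagram q).filter fun t =>
      t.2.1 = (j : WithTop (Fin m)) ∧ t.2.2 ≠ Finset.univ).card := by
    rw [countPartialDying, countP_eq_card_filter h hl hmem
      (fun t => t.2.1 = (j : WithTop (Fin m)) ∧ t.2.2 ≠ Q)]
    simp only [Ne, h.primeProd_eq_iff]
  have hborn : IsBornIn j l →
      ∃ t ∈ K.multiDiagram q, s₀ ∉ t.2.2 ∧ Touches t.1 t.2.1 j := by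
    rintro ⟨j', n', hn'⟩
    obtain ⟨S, hS, _⟩ := (hmem _ _ _).1 hn'
    have hlt := hK.lt hS
    rcases hlast' with ⟨_, S', hS'⟩ | ⟨k, S', _, hS'⟩
    · exact hK.exists_touches_of_ne s₀ hS hS' (by simp) (Or.inl rfl) (Or.inl rfl)
    · refine hK.exists_touches_of_ne s₀ hS hS' (fun he => ?_) (Or.inl rfl) (Or.inr rfl)
      simp only [Prod.mk.injEq, WithTop.coe_inj] at he
      exact hlt.ne he.2.1.symm
  have hclear : (if IsBornIn j l then 6 * r else 0) ≤ 6 * r *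
      if ∃ t ∈ K.multiDiagram q, s₀ ∉ t.2.2 ∧ Touches t.1 t.2.1 j then 1 else 0 := by
    by_cases hb : IsBornIn j l
    · rw [if_pos hb, if_pos (hborn hb), mul_one]
    · rw [if_neg hb]; exact Nat.zero_le _
  -- All the terms are bounded by multiples of `D * W`.
  have hnW : n ^ 2 ≤ W := (Nat.le_mul_of_pos_right _ (by omega)).trans hbudget
  have hLW : n * K.numDying q j ≤ W := by
    refine le_trans (Nat.mul_le_mul ?_ (le_max_right _ _)) hbudget
    rw [sq]; exact Nat.le_mul_of_pos_left _ hn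
  have hn2 : n ≤ n ^ 2 := by rw [sq]; exact Nat.le_mul_of_pos_left _ hn
  have hDW : D * n ^ 2 ≤ D * W := Nat.mul_le_mul_left _ hnW
  have hDn : n ^ 2 ≤ D * n ^ 2 := Nat.le_mul_of_pos_left _ hD
  have e₁ : 7 * D * scanSum j lo j l ≤ 7 * (D * W) + 7 * D * excess K q j := by
    calc _ ≤ 7 * D * (n ^ 2 + excess K q j) := Nat.mul_le_mul_left _ hscan
      _ = 7 * (D * n ^ 2) + 7 * D * excess K q j := by ring
      _ ≤ _ := by omega
  have e₂ : ((j : ℕ) - lo + 1) * (2 * (D * (j + 1 - lo)) + 9) ≤ 26 * (D * W) := by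
    calc _ ≤ (2 * n) * (2 * (D * (2 * n)) + 9) := by gcongr; omega
      _ = 8 * (D * n ^ 2) + 18 * n := by ring
      _ ≤ _ := by omega
  have e₃ : countDying j l * (10 + 5 * (D * (j + 1 - lo))) ≤ 20 * (D * W) := by
    have hL : K.numDying q j ≤ n * K.numDying q j := Nat.le_mul_of_pos_left _ hn
    have hLD : K.numDying q j ≤ D * W := (hL.trans hLW).trans (Nat.le_mul_of_pos_left _ hD)
    have hDL : D * (n * K.numDying q j) ≤ D * W := Nat.mul_le_mul_left _ hLW
    calc _ ≤ K.numDying q j * (10 + 5 * (D * (2 * n))) := by rw [hdying]; gcongr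
      _ = 10 * K.numDying q j + 10 * (D * (n * K.numDying q j)) := by ring
      _ ≤ _ := by omega
  have e₄ : 3 + 3 * D ≤ 6 * (D * W) := by
    have : D * 1 ≤ D * W := Nat.mul_le_mul_left _ (by omega)
    omega
  rw [hpartial] at hx
  rw [Nat.mul_add, mul_assoc 59]
  have e₅ := Nat.mul_comm ((K.multiDiagram q).filter fun t =>
      t.2.1 = (j : WithTop (Fin m)) ∧ t.2.2 ≠ Finset.univ).card (6 * r)
  omega

end Output

/-- The number of operations of the algorithm. -/
theorem cost_modularReconstruction_le {D : ℕ} (hD : ∀ j, (K.simplex j).card ≤ D) (hD₁ : 1 ≤ D)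
    (h : IsPrimeFamily q (∏ s, q s)) (s₀ : Fin r) :
    (modularReconstruction K q).cost ≤
      30 * (r * ((K.multiDiagram q).filter fun t => s₀ ∉ t.2.2).card) +
        80 * (D * ∑ j, columnBudget K q j) := by
  obtain ⟨hl, hmem, hK, f, hf, hcost⟩ := modularReconstruction_spec hD h
  have hK : K.IsPaired q := hK
  set N := ((K.multiDiagram q).filter fun t => s₀ ∉ t.2.2).card
  set W := ∑ j, columnBudget K q j
  have hsum := Finset.sum_le_sum fun j (_ : j ∈ Finset.univ) =>
    (hcost j).le h hl hmem hK hD₁ s₀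
  simp only [Finset.sum_add_distrib, ← Finset.mul_sum, Finset.sum_const, Finset.card_univ,
    Fintype.card_fin, smul_eq_mul, Finset.sum_boole, Nat.cast_id] at hsum
  rw [show ∑ j, columnBudget K q j = W from rfl] at hsum
  have e₁ := hK.sum_card_filter_ne_univ_le s₀
  have e₂ := card_touched_le (K := K) (q := q) s₀
  have e₃ : m ≤ 2 * W := (hK.le_two_mul_card s₀).trans
    (Nat.mul_le_mul_left _ (card_multiDiagram_le hK))
  have e₄ : 7 * D * ∑ j, excess K q j ≤ 7 * D * W := Nat.mul_le_mul_left _ sum_excess_le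
  have e₅ : 6 * r * ((∑ j : Fin m, ((K.multiDiagram q).filter fun t =>
      t.2.1 = (j : WithTop (Fin m)) ∧ t.2.2 ≠ Finset.univ).card) +
      (Finset.univ.filter fun j : Fin m =>
        ∃ t ∈ K.multiDiagram q, s₀ ∉ t.2.2 ∧ Touches t.1 t.2.1 j).card) ≤
      6 * r * (5 * N) := Nat.mul_le_mul_left _ (by omega)
  have e₆ : W ≤ D * W := Nat.le_mul_of_pos_left _ hD₁
  have e₇ : 6 * r * (5 * N) = 30 * (r * N) := by ring
  have e₈ : 7 * D * W = 7 * (D * W) := by ring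
  have e₉ : 59 * D * W = 59 * (D * W) := by ring
  rw [hf]
  omega

/-- The total budget of the columns, written as in the bound on the running time. -/
theorem cast_sum_columnBudget (hK : K.IsPaired q) :
    ((∑ j, columnBudget K q j : ℕ) : ℝ) =
      (∑ j : Fin m, ∑ t ∈ (K.multiDiagram q).filter
          (fun t => t.2.1 = (j : WithTop (Fin m))),
          |((j : ℕ) : ℝ) - ((t.1 : ℕ) : ℝ)| ^ 2 * (K.numDying q j : ℝ)) +
        ∑ t ∈ (K.multiDiagram q).filter (fun t => t.2.1 = ⊤),
          (((t.1 : ℕ) : ℝ) + 1) ^ 2 * max 1 (K.numDying q t.1 : ℝ) := by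
  simp only [columnBudget, Finset.sum_add_distrib]
  push_cast
  congr 1
  · refine Finset.sum_congr rfl fun j _ => Finset.sum_congr rfl fun t ht => ?_
    obtain ⟨ht, hj⟩ := Finset.mem_filter.1 ht
    have hlt : (t.1 : ℕ) < j := hK.lt (S := t.2.2) (by rw [← hj]; exact ht)
    rw [Nat.cast_sub hlt.le, sq_abs]
  · rw [← Finset.sum_fiberwise ((K.multiDiagram q).filter (fun t => t.2.1 = ⊤)) (fun t => t.1)]
    refine Finset.sum_congr rfl fun j _ => ?_
    rw [Finset.filter_filter]
    refine Finset.sum_congr rfl fun t ht => ?_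
    rw [(Finset.mem_filter.1 ht).2.2]

end Summation

end MultiField

open Classical in
theorem mainTheorem4 :
    ∃ C : ℝ, ∀ (m d r : ℕ) (K : MultiField.FilteredComplex m) (q : Fin r → ℕ)
      (tAdd tMul tDiv tMem A : ℝ),
      1 ≤ d →
      (∀ j, (K.simplex j).card ≤ d + 1) →
      (∀ s, (q s).Prime) →
      Function.Injective q →
      (0 ≤ tAdd ∧ tAdd ≤ A) → (0 ≤ tMul ∧ tMul ≤ A) → (0 ≤ tDiv ∧ tDiv ≤ A) →
      (0 ≤ tMem ∧ tMem ≤ A) →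
      ((MultiField.modularReconstruction K q).val.Nodup ∧
        ∀ (i : Fin m) (j : WithTop (Fin m)) (n : ℕ),
          (i, j, n) ∈ (MultiField.modularReconstruction K q).val ↔
            ∃ S, (i, j, S) ∈ K.multiDiagram q ∧ n = ∏ s ∈ S, q s) ∧
      ∀ s₀ : Fin r,
        (MultiField.modularReconstruction K q).ops.time tAdd tMul tDiv tMem ≤
          C * (A * r * (((K.multiDiagram q).card : ℝ) - (K.diagram (ZMod (q s₀))).card)
            + A * d *
              ((∑ j : Fin m, ∑ t ∈ (K.multiDiagram q).filter
                  (fun t => t.2.1 = (j : WithTop (Fin m))),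
                  |((j : ℕ) : ℝ) - ((t.1 : ℕ) : ℝ)| ^ 2 * (K.numDying q j : ℝ))
                + ∑ t ∈ (K.multiDiagram q).filter (fun t => t.2.1 = ⊤),
                  (((t.1 : ℕ) : ℝ) + 1) ^ 2 * max 1 (K.numDying q t.1 : ℝ))) := by
  refine ⟨160, fun m d r K q tAdd tMul tDiv tMem A hd hcard hprime hinj hAdd hMul hDiv hMem => ?_⟩
  have h : MultiField.IsPrimeFamily q (∏ s, q s) := ⟨hprime, hinj, rfl⟩
  obtain ⟨hl, hmem, hK, _⟩ := MultiField.modularReconstruction_spec hcard h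
  refine ⟨⟨hl, hmem⟩, fun s₀ => ?_⟩
  have hcost := MultiField.cost_modularReconstruction_le hcard (Nat.le_add_left 1 d) h s₀
  have hA : 0 ≤ A := hAdd.1.trans hAdd.2
  rw [← MultiField.cast_sum_columnBudget hK, ← MultiField.card_filter_notMem_multiDiagram s₀]
  refine (MultiField.OpCount.time_le _ hAdd.2 hMul.2 hDiv.2 hMem.2).trans ?_
  set N := ((K.multiDiagram q).filter fun t => s₀ ∉ t.2.2).card
  set W := ∑ j, MultiField.columnBudget K q j
  have hd2 : (d + 1) * W ≤ 2 * (d * W) := by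
    rw [← mul_assoc]
    exact Nat.mul_le_mul_right _ (by omega)
  have hle : (MultiField.modularReconstruction K q).ops.total ≤ 160 * (r * N + d * W) := by
    change (MultiField.modularReconstruction K q).cost ≤ _
    omega
  calc A * ((MultiField.modularReconstruction K q).ops.total : ℝ)
      ≤ A * ((160 * (r * N + d * W) : ℕ) : ℝ) := by
        exact mul_le_mul_of_nonneg_left (Nat.cast_le.2 hle) hA
    _ = _ := by push_cast; ring
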